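/- Let $n\ge 1$. For a real analytic function $\Phi$ near $0\in\mathbb{C}^n$ write $\Phi(z)=\Phi(z,\bar z)$ for its power series at $0$. A local dual of $\Phi$ is a pair $(M^*,\Phi^*)$ with $M^*\ni 0$ a connected open set and $\Phi^*:M^*\to\mathbb{R}$ real analytic and strictly plurisubharmonic such that $\Phi^*(z)=-\Phi(z,-\bar z)$ near $0$. Let $M\ni 0$ be a domain of $\mathbb{C}^n$, let $\Phi$ be real analytic and strictly plurisubharmonic on $M$, and put $\omega=\frac i2\partial\bar\partial\Phi$, $\omega^*=\frac i2\partial\bar\partial\Phi^*$, $\omega_0=\frac i2\sum_j dz_j\wedge d\bar z_j$. For $\lambda>0$, $\omega$ admits a $\lambda$-symplectic duality if there are a local dual $(M^*,\Phi^*)$, open neighbourhoods $U\subset M$ and $U^*\subset M^*$ of $0$ and a diffeomorphism $\Psi:U\to U^*$ with $\Psi^*\omega_0=\lambda\omega$ and $\Psi^*(\lambda\omega^*)=\omega_0$. 1. Let $\lambda>0$, let $f$ be a real function that is real analytic near $0\in\mathbb{R}$, and let $G(x)=-\lambda x f'(x)$. The radial duality equation $$\lambda^2 f'(x)\,f'(-\lambda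 x f'(x))=1$$ holds for all $x$ in a neighbourhood of $0$ if and only if $G(G(x))=x$ for all $x$ in a neighbourhood of $0$. 2. The function $$G(x)=-\frac{\sqrt2}{2}+x+\frac12\sqrt{2-8\sqrt2\,x}$$ is real analytic at $0$ and satisfies $G(0)=0$ and $G(G(x))=x$ for all $x$ in a neighbourhood of $0$. 3. Let $G$ be the function of part 2 and let $\lambda>0$. There is a real function $f$, real analytic near $0$, with $-\lambda x f'(x)=G(x)$ near $0$. Every such $f$ satisfies the radial duality equation near $0$ and $f'(0)=1/\lambda$, and there is a ball $B=\{|z|<R\}\subset\mathbb{C}^n$, $R>0$, on which the radial potential $\Phi(z)=f(|z|^2)$ is real analytic and strictly plurisubharmonic, and the Kähler form $\omega=\frac i2\partial\bar\partial\Phi$ on $B$ admits a $\lambda$-symplectic duality, but the Kähler metric of $\omega$ does not have constant holomorphic sectional curvature on any non-empty open subset of $B$. -/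

import Mathlib

open Filter Topology
open scoped ContDiff ComplexConjugate Matrix

noncomputable section

namespace SymplecticDuality

/-! ### Kähler geometry of a potential on a domain of `ℂⁿ` -/

/-- Complex `n`-space with its Euclidean norm `‖z‖ ^ 2 = |z₁|² + ⋯ + |zₙ|²`. -/
abbrev Cn (n : ℕ) : Type := EuclideanSpace ℂ (Fin n)

variable {n : ℕ}

/-- The Wirtinger derivative `∂F/∂z_j = (∂F/∂x_j - i ∂F/∂y_j) / 2`. -/
def dz (j : Fin n) (F : Cn n → ℂ) (z : Cn n) : ℂ :=
  (1 / 2 : ℂ) *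
    (fderiv ℝ F z (EuclideanSpace.single j 1) -
      Complex.I * fderiv ℝ F z (EuclideanSpace.single j Complex.I))

/-- The Wirtinger derivative `∂F/∂z̄_j = (∂F/∂x_j + i ∂F/∂y_j) / 2`. -/
def dzbar (j : Fin n) (F : Cn n → ℂ) (z : Cn n) : ℂ :=
  (1 / 2 : ℂ) *
    (fderiv ℝ F z (EuclideanSpace.single j 1) +
      Complex.I * fderiv ℝ F z (EuclideanSpace.single j Complex.I))

/-- The complex Hessian `h_{j k̄} = ∂²Φ / ∂z_j ∂z̄_k`. -/
def leviMatrix (Φ : Cn n → ℝ) (z : Cn n) : Matrix (Fin n) (Fin n) ℂ :=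
  Matrix.of fun j k => dz j (fun y => dzbar k (fun x => (Φ x : ℂ)) y) z

/-- The real 2-form `ω = (i/2) ∂∂̄Φ = (i/2) ∑ h_{j k̄} dz_j ∧ dz̄_k`, at the point `z`, on the
tangent vectors `u`, `v`. -/
def kahlerForm (Φ : Cn n → ℝ) (z u v : Cn n) : ℂ :=
  (Complex.I / 2) *
    ∑ j, ∑ k, leviMatrix Φ z j k * (u j * conj (v k) - v j * conj (u k))

/-- The flat form `ω₀ = (i/2) ∑ dz_j ∧ dz̄_j`. -/
def flatForm (u v : Cn n) : ℂ :=
  (Complex.I / 2) * ∑ j, (u j * conj (v j) - v j * conj (u j))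

/-- The Levi form `∑ h_{j k̄} u_j ū_k`, which is the squared length `ω(u, i u)` of `u` in the
Kähler metric with form `ω = (i/2) ∂∂̄Φ`. -/
def leviForm (Φ : Cn n → ℝ) (z u : Cn n) : ℝ :=
  (∑ j, ∑ k, leviMatrix Φ z j k * (u j * conj (u k))).re

/-- `Φ` is a real analytic strictly plurisubharmonic function on `M`, that is, a Kähler potential
of the real analytic Kähler form `(i/2) ∂∂̄Φ` on `M`. -/
def IsKahlerPotentialOn (Φ : Cn n → ℝ) (M : Set (Cn n)) : Prop :=
  AnalyticOnNhd ℝ Φ M ∧ ∀ z ∈ M, ∀ u : Cn n, u ≠ 0 → 0 < leviForm Φ z u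

/-- The curvature tensor of the Kähler metric with potential `Φ`,
`R_{i j̄ k l̄} = - ∂_k ∂̄_l h_{i j̄} + ∑_{p, q} (∂_k h_{i q̄}) h^{q̄ p} (∂̄_l h_{p j̄})`. -/
def curvatureTensor (Φ : Cn n → ℝ) (z : Cn n) (i j k l : Fin n) : ℂ :=
  - dz k (fun y => dzbar l (fun x => leviMatrix Φ x i j) y) z +
    ∑ q, ∑ p, dz k (fun x => leviMatrix Φ x i q) z * (leviMatrix Φ z)⁻¹ q p *
      dzbar l (fun x => leviMatrix Φ x p j) z

/-- The holomorphic sectional curvature at `z` in the direction `v`: the sectional curvature of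
the real plane spanned by `v` and `i v` for the Riemannian metric `g(u, w) = ω(u, i w)`. -/
def holomorphicSectionalCurvature (Φ : Cn n → ℝ) (z v : Cn n) : ℝ :=
  2 * (∑ i, ∑ j, ∑ k, ∑ l,
      curvatureTensor Φ z i j k l * (v i * conj (v j) * v k * conj (v l))).re /
    leviForm Φ z v ^ 2

/-- The Kähler metric with potential `Φ` has constant (holomorphic sectional) curvature on `W`. -/
def HasConstantHolomorphicCurvatureOn (Φ : Cn n → ℝ) (W : Set (Cn n)) : Prop :=
  ∃ c : ℝ, ∀ z ∈ W, ∀ v : Cn n, v ≠ 0 → holomorphicSectionalCurvature Φ z v = c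

/-! ### Local duals and symplectic dualities -/

/-- `(Mstar, Φstar)` is a local dual of a real analytic potential `Φ` defined around the origin:
`Φstar` is a Kähler potential on the domain `Mstar ∋ 0` and `Φstar(z, z̄) = -Φ(z, -z̄)`. Here
`P(z, w)` is the sum of the power series of `Φ` at the origin in the independent variables `z` and
`w = z̄`. -/
def IsLocalDual (Φ : Cn n → ℝ) (Mstar : Set (Cn n)) (Φstar : Cn n → ℝ) : Prop :=
  IsOpen Mstar ∧ IsConnected Mstar ∧ (0 : Cn n) ∈ Mstar ∧ IsKahlerPotentialOn Φstar Mstar ∧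
    ∃ P : (Fin n → ℂ) × (Fin n → ℂ) → ℂ, AnalyticAt ℂ P 0 ∧
      (∀ᶠ z : Cn n in 𝓝 0, (Φ z : ℂ) = P (fun j => z j, fun j => conj (z j))) ∧
      (∀ᶠ z : Cn n in 𝓝 0, (Φstar z : ℂ) = - P (fun j => z j, fun j => - conj (z j)))

/-- `Ψ : U → Ustar` (its source and target) is a `lam`-symplectic duality between the Kähler forms
`ω = (i/2) ∂∂̄Φ` on `M` and `ωstar = (i/2) ∂∂̄Φstar` on `Mstar`: a diffeomorphism between open
neighbourhoods of the origin `U ⊆ M` and `Ustar ⊆ Mstar` such that `Ψ^* ω₀ = lam ω` and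
`Ψ^* (lam ωstar) = ω₀`. -/
structure IsSymplecticDuality (lam : ℝ) (M : Set (Cn n)) (Φ : Cn n → ℝ)
    (Mstar : Set (Cn n)) (Φstar : Cn n → ℝ) (Ψ : OpenPartialHomeomorph (Cn n) (Cn n)) : Prop where
  lam_pos : 0 < lam
  source_subset : Ψ.source ⊆ M
  target_subset : Ψ.target ⊆ Mstar
  zero_mem_source : (0 : Cn n) ∈ Ψ.source
  zero_mem_target : (0 : Cn n) ∈ Ψ.target
  contDiffOn : ContDiffOn ℝ ∞ Ψ Ψ.source
  contDiffOn_symm : ContDiffOn ℝ ∞ Ψ.symm Ψ.target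
  pullback_flat : ∀ z ∈ Ψ.source, ∀ u v : Cn n,
    flatForm (fderiv ℝ Ψ z u) (fderiv ℝ Ψ z v) = (lam : ℂ) * kahlerForm Φ z u v
  pullback_dual : ∀ z ∈ Ψ.source, ∀ u v : Cn n,
    (lam : ℂ) * kahlerForm Φstar (Ψ z) (fderiv ℝ Ψ z u) (fderiv ℝ Ψ z v) = flatForm u v

/-- The Kähler form `(i/2) ∂∂̄Φ` on `M` admits a `lam`-symplectic duality. -/
def AdmitsSymplecticDuality (lam : ℝ) (M : Set (Cn n)) (Φ : Cn n → ℝ) : Prop :=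
  ∃ (Mstar : Set (Cn n)) (Φstar : Cn n → ℝ) (Ψ : OpenPartialHomeomorph (Cn n) (Cn n)),
    IsLocalDual Φ Mstar Φstar ∧ IsSymplecticDuality lam M Φ Mstar Φstar Ψ

/-! ### The radial case -/

/-- The radial potential `Φ(z) = f(|z|²)`. -/
def radialPotential (n : ℕ) (f : ℝ → ℝ) (z : Cn n) : ℝ := f (‖z‖ ^ 2)

/-- The radial duality equation `lam² f'(x) f'(-lam x f'(x)) = 1` on a neighbourhood of `0`. -/
def RadialDualityEquation (lam : ℝ) (f : ℝ → ℝ) : Prop :=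
  ∀ᶠ x in 𝓝 (0 : ℝ), lam ^ 2 * deriv f x * deriv f (-lam * x * deriv f x) = 1

/-- The function `G(x) = -lam x f'(x)`. -/
def dualityMap (lam : ℝ) (f : ℝ → ℝ) (x : ℝ) : ℝ := -lam * x * deriv f x

/-- The function `G(x) = -√2/2 + x + ½ √(2 - 8 √2 x)`. -/
def explicitG (x : ℝ) : ℝ :=
  -(√2 / 2) + x + 1 / 2 * √(2 - 8 * √2 * x)

end SymplecticDuality

end

/-!
Put `r = |z|²` and `α = ∑ z̄_j dz_j`. The Kähler form of a radial potential `f(|z|²)` is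
`(i/2) (f'(r) ∑ dz_j ∧ dz̄_j + f''(r) α ∧ ᾱ)` (`kahlerForm_radialPotential`), and a radial map
`z ↦ a(r) z` pulls `∑ dz_j ∧ dz̄_j` back to `a² ∑ dz_j ∧ dz̄_j + (a²)' α ∧ ᾱ`. Hence
`Ψ z = √(lam f'(r)) z` satisfies `Ψ^* ω₀ = lam ω` (`flatForm_fderiv_radialDarbouxMap`).

The dual potential is radial too, with profile `x ↦ -f(-x)` (`dualProfile`); the polarised power
series is `F(∑ z_j w_j)` for the complex analytic extension `F` of `f`. Let `Θ` be the map attached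
to the dual profile, so that `Θ^* ω₀ = lam ω^*`. As `|Ψ z|² = lam r f'(r) = -G(r)`, the composition
`Θ ∘ Ψ` multiplies `z` by `√(lam² f'(r) f'(G(r)))`, and the radial duality equation says exactly
that this factor is `1` (`radialDarbouxMap_dualProfile`). The equation is inherited by the dual
profile, so `Ψ ∘ Θ` is the identity as well, and
`Ψ^* (lam ω^*) = Ψ^* Θ^* ω₀ = ω₀`. This is `admitsSymplecticDuality_radialPotential`.

The equivalence of the duality equation with `G ∘ G = id` is the identity
`G(G(x)) = x lam² f'(x) f'(G(x))` together with continuity at `x = 0`. In the coordinate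
`t = √(2 - 8 √2 x)` the explicit `G` is the reflection `t ↦ 2 √2 - t`.

For the curvature it is enough to look in the radial direction `v = z`. There the holomorphic
sectional curvature is that of the complex line through `z`, with conformal factor
`h = (r f'(r))' = -G'(r) / lam` (`holomorphicSectionalCurvature_radialPotential`). For the explicit
`G`, in terms of `t`, it equals a constant `c` precisely when
`-64 √2 + 48 t - 8 t³ = (c / (2 lam)) ((2 √2 - t) t)³`. Were the curvature constant on an open set,
this would hold for all `t` in an interval, hence identically, contradicting the values at `t = 0`.
-/

namespace SymplecticDuality

variable {n : ℕ}

/-! ### Wirtinger calculus -/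

/-- `F` is real differentiable at `z` with `∂F/∂z_j = p j` and `∂F/∂z̄_j = q j`, that is, its
differential is `∑ j, (p j dz_j + q j dz̄_j)`. -/
def HasWirtingerAt (F : Cn n → ℂ) (p q : Fin n → ℂ) (z : Cn n) : Prop :=
  ∃ L : Cn n →L[ℝ] ℂ, HasFDerivAt F L z ∧ ∀ u, L u = ∑ j, (p j * u j + q j * conj (u j))

theorem HasWirtingerAt.fderiv_apply {F : Cn n → ℂ} {p q : Fin n → ℂ} {z : Cn n}
    (h : HasWirtingerAt F p q z) (u : Cn n) :
    fderiv ℝ F z u = ∑ j, (p j * u j + q j * conj (u j)) := by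
  obtain ⟨L, hL, hu⟩ := h
  rw [hL.fderiv, hu]

theorem HasWirtingerAt.fderiv_single {F : Cn n → ℂ} {p q : Fin n → ℂ} {z : Cn n}
    (h : HasWirtingerAt F p q z) (j : Fin n) (c : ℂ) :
    fderiv ℝ F z (EuclideanSpace.single j c) = p j * c + q j * conj c := by
  rw [h.fderiv_apply, Finset.sum_eq_single j]
  · simp
  · intro k _ hk
    simp [hk]
  · simp

theorem HasWirtingerAt.dz_eq {F : Cn n → ℂ} {p q : Fin n → ℂ} {z : Cn n}
    (h : HasWirtingerAt F p q z) (j : Fin n) : dz j F z = p j := by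
  simp only [dz, h.fderiv_single, map_one, Complex.conj_I]
  linear_combination (-(1 / 2) * p j + (1 / 2) * q j) * Complex.I_mul_I

theorem HasWirtingerAt.dzbar_eq {F : Cn n → ℂ} {p q : Fin n → ℂ} {z : Cn n}
    (h : HasWirtingerAt F p q z) (j : Fin n) : dzbar j F z = q j := by
  simp only [dzbar, h.fderiv_single, map_one, Complex.conj_I]
  linear_combination ((1 / 2) * p j - (1 / 2) * q j) * Complex.I_mul_I

theorem HasWirtingerAt.congr {F G : Cn n → ℂ} {p q p' q' : Fin n → ℂ} {z : Cn n}
    (h : HasWirtingerAt F p q z) (hG : G =ᶠ[𝓝 z] F) (hp : ∀ j, p' j = p j)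
    (hq : ∀ j, q' j = q j) : HasWirtingerAt G p' q' z := by
  obtain ⟨L, hL, hu⟩ := h
  exact ⟨L, hL.congr_of_eventuallyEq hG, fun u => by simp only [hu, hp, hq]⟩

theorem HasWirtingerAt.add {F G : Cn n → ℂ} {p q p' q' : Fin n → ℂ} {z : Cn n}
    (hF : HasWirtingerAt F p q z) (hG : HasWirtingerAt G p' q' z) :
    HasWirtingerAt (fun y => F y + G y) (fun j => p j + p' j) (fun j => q j + q' j) z := by
  obtain ⟨L, hL, hu⟩ := hF
  obtain ⟨L', hL', hu'⟩ := hG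
  refine ⟨L + L', hL.add hL', fun u => ?_⟩
  rw [add_apply, hu, hu', ← Finset.sum_add_distrib]
  exact Finset.sum_congr rfl fun j _ => by ring

theorem HasWirtingerAt.mul {F G : Cn n → ℂ} {p q p' q' : Fin n → ℂ} {z : Cn n}
    (hF : HasWirtingerAt F p q z) (hG : HasWirtingerAt G p' q' z) :
    HasWirtingerAt (fun y => F y * G y) (fun j => p j * G z + F z * p' j)
      (fun j => q j * G z + F z * q' j) z := by
  obtain ⟨L, hL, hu⟩ := hF
  obtain ⟨L', hL', hu'⟩ := hG
  refine ⟨_, hL.mul hL', fun u => ?_⟩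
  simp only [add_apply, smul_apply, hu, hu', smul_eq_mul,
    Finset.mul_sum, ← Finset.sum_add_distrib]
  exact Finset.sum_congr rfl fun j _ => by ring

theorem hasWirtingerAt_const (c : ℂ) (z : Cn n) :
    HasWirtingerAt (fun _ => c) (fun _ => 0) (fun _ => 0) z :=
  ⟨0, hasFDerivAt_const c z, fun u => by simp⟩

theorem hasWirtingerAt_coord (k : Fin n) (z : Cn n) :
    HasWirtingerAt (fun y => y k) (fun j => if j = k then 1 else 0) (fun _ => 0) z := by
  refine ⟨(EuclideanSpace.proj k : Cn n →L[ℂ] ℂ).restrictScalars ℝ,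
    ((EuclideanSpace.proj k : Cn n →L[ℂ] ℂ).restrictScalars ℝ).hasFDerivAt, fun u => ?_⟩
  simp

theorem hasWirtingerAt_conj_coord (k : Fin n) (z : Cn n) :
    HasWirtingerAt (fun y => conj (y k)) (fun _ => 0) (fun j => if j = k then 1 else 0) z := by
  refine ⟨(Complex.conjCLE : ℂ →L[ℝ] ℂ).comp
      ((EuclideanSpace.proj k : Cn n →L[ℂ] ℂ).restrictScalars ℝ),
    ((Complex.conjCLE : ℂ →L[ℝ] ℂ).comp
      ((EuclideanSpace.proj k : Cn n →L[ℂ] ℂ).restrictScalars ℝ)).hasFDerivAt, fun u => ?_⟩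
  simp

theorem ofReal_norm_sq (z : Cn n) : ((‖z‖ ^ 2 : ℝ) : ℂ) = ∑ j, z j * conj (z j) := by
  rw [EuclideanSpace.norm_sq_eq]
  push_cast
  exact Finset.sum_congr rfl fun j _ => (Complex.mul_conj' (z j)).symm

theorem hasFDerivAt_norm_sq (z : Cn n) : ∃ L : Cn n →L[ℝ] ℝ,
    HasFDerivAt (fun y : Cn n => ‖y‖ ^ 2) L z ∧
      ∀ u, ((L u : ℝ) : ℂ) = ∑ j, (conj (z j) * u j + z j * conj (u j)) := by
  have h1 : DifferentiableAt ℝ (fun y : Cn n => ‖y‖ ^ 2) z :=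
    ((contDiff_norm_sq ℂ (n := 1)).differentiable (by norm_num)) z
  refine ⟨_, h1.hasFDerivAt, fun u => ?_⟩
  have h2 : HasFDerivAt (fun y : Cn n => ((‖y‖ ^ 2 : ℝ) : ℂ))
      (Complex.ofRealCLM.comp (fderiv ℝ (fun y : Cn n => ‖y‖ ^ 2) z)) z :=
    Complex.ofRealCLM.hasFDerivAt.comp z h1.hasFDerivAt
  have h3 : HasFDerivAt (fun y : Cn n => ∑ j, y j * conj (y j))
      (∑ j, fderiv ℝ (fun y : Cn n => y j * conj (y j)) z) z := by
    refine HasFDerivAt.fun_sum fun j _ => ?_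
    obtain ⟨L, hL, -⟩ := (hasWirtingerAt_coord j z).mul (hasWirtingerAt_conj_coord j z)
    exact hL.differentiableAt.hasFDerivAt
  simp only [← ofReal_norm_sq] at h3
  have h4 := DFunLike.congr_fun (h2.unique h3) u
  rw [sum_apply] at h4
  refine h4.trans (Finset.sum_congr rfl fun j _ => ?_)
  rw [((hasWirtingerAt_coord j z).mul (hasWirtingerAt_conj_coord j z)).fderiv_apply,
    Finset.sum_eq_single j]
  · simp
  · intro k _ hk
    simp [hk]
  · simp

theorem hasWirtingerAt_radial {a : ℝ → ℝ} {a' : ℝ} {z : Cn n} (ha : HasDerivAt a a' (‖z‖ ^ 2)) :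
    HasWirtingerAt (fun y => (a (‖y‖ ^ 2) : ℂ)) (fun j => a' * conj (z j)) (fun j => a' * z j)
      z := by
  obtain ⟨L, hL, hu⟩ := hasFDerivAt_norm_sq z
  refine ⟨Complex.ofRealCLM.comp (a' • L),
    Complex.ofRealCLM.hasFDerivAt.comp z (ha.comp_hasFDerivAt z hL), fun u => ?_⟩
  simp only [ContinuousLinearMap.comp_apply, smul_apply, smul_eq_mul,
    Complex.ofRealCLM_apply, Complex.ofReal_mul, hu, Finset.mul_sum]
  exact Finset.sum_congr rfl fun j _ => by ring

theorem eventually_analyticAt_norm_sq {f : ℝ → ℝ} {z : Cn n} (hf : AnalyticAt ℝ f (‖z‖ ^ 2)) :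
    ∀ᶠ y : Cn n in 𝓝 z, AnalyticAt ℝ f (‖y‖ ^ 2) := by
  have hc : Continuous fun y : Cn n => ‖y‖ ^ 2 := by fun_prop
  exact hc.continuousAt.eventually hf.eventually_analyticAt

/-! ### The metric of a radial potential -/

theorem leviMatrix_radialPotential {f : ℝ → ℝ} {z : Cn n} (hf : AnalyticAt ℝ f (‖z‖ ^ 2))
    (j k : Fin n) :
    leviMatrix (radialPotential n f) z j k =
      ((deriv f (‖z‖ ^ 2) : ℝ) : ℂ) * (if j = k then 1 else 0) +
        ((deriv (deriv f) (‖z‖ ^ 2) : ℝ) : ℂ) * (conj (z j) * z k) := by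
  have h1 : (fun y => dzbar k (fun x => (radialPotential n f x : ℂ)) y) =ᶠ[𝓝 z]
      fun y => ((deriv f (‖y‖ ^ 2) : ℝ) : ℂ) * y k := by
    filter_upwards [eventually_analyticAt_norm_sq hf] with y hy
    exact (hasWirtingerAt_radial hy.differentiableAt.hasDerivAt).dzbar_eq k
  have h2 := ((hasWirtingerAt_radial hf.deriv.differentiableAt.hasDerivAt).mul
    (hasWirtingerAt_coord k z)).congr h1 (fun _ => rfl) (fun _ => rfl)
  rw [leviMatrix, Matrix.of_apply, h2.dz_eq]
  ring

/-- The contraction of the complex Hessian of `f(|z|²)` with `u` and `v̄`. -/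
theorem sum_leviMatrix_radialPotential {f : ℝ → ℝ} {z : Cn n} (hf : AnalyticAt ℝ f (‖z‖ ^ 2))
    (u v : Cn n) :
    ∑ j, ∑ k, leviMatrix (radialPotential n f) z j k * (u j * conj (v k)) =
      ((deriv f (‖z‖ ^ 2) : ℝ) : ℂ) * ∑ j, u j * conj (v j) +
        ((deriv (deriv f) (‖z‖ ^ 2) : ℝ) : ℂ) * ((∑ j, conj (z j) * u j) * ∑ j, z j * conj (v j)) := by
  simp only [leviMatrix_radialPotential hf, add_mul, Finset.sum_add_distrib]
  congr 1
  · rw [Finset.mul_sum]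
    refine Finset.sum_congr rfl fun j _ => ?_
    simp
  · rw [Finset.sum_mul_sum, Finset.mul_sum]
    refine Finset.sum_congr rfl fun j _ => ?_
    rw [Finset.mul_sum]
    exact Finset.sum_congr rfl fun k _ => by ring

theorem leviForm_radialPotential {f : ℝ → ℝ} {z : Cn n} (hf : AnalyticAt ℝ f (‖z‖ ^ 2))
    (u : Cn n) :
    leviForm (radialPotential n f) z u =
      deriv f (‖z‖ ^ 2) * ‖u‖ ^ 2 +
        deriv (deriv f) (‖z‖ ^ 2) * ‖∑ j, conj (z j) * u j‖ ^ 2 := by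
  have h1 : ∑ j, z j * conj (u j) = conj (∑ j, conj (z j) * u j) := by simp
  rw [leviForm, sum_leviMatrix_radialPotential hf, ← ofReal_norm_sq, h1, Complex.mul_conj']
  norm_cast

/-- By the Cauchy-Schwarz inequality the Levi form of `f(|z|²)` lies between `f'(r) |u|²` and
`(f'(r) + r f''(r)) |u|²`, `r = |z|²`; these are its extreme values, on the complex orthogonal
complement of `z` and on the complex line of `z`. -/
theorem leviForm_radialPotential_pos {f : ℝ → ℝ} {z : Cn n} (hf : AnalyticAt ℝ f (‖z‖ ^ 2))
    (h1 : 0 < deriv f (‖z‖ ^ 2))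
    (h2 : 0 < deriv f (‖z‖ ^ 2) + ‖z‖ ^ 2 * deriv (deriv f) (‖z‖ ^ 2)) {u : Cn n} (hu : u ≠ 0) :
    0 < leviForm (radialPotential n f) z u := by
  rw [leviForm_radialPotential hf]
  have hu' : 0 < ‖u‖ ^ 2 := by positivity
  have hcs : ‖∑ j, conj (z j) * u j‖ ≤ ‖z‖ * ‖u‖ := by
    have h := norm_inner_le_norm (𝕜 := ℂ) z u
    simpa [PiLp.inner_apply, mul_comm] using h
  have hcs2 : ‖∑ j, conj (z j) * u j‖ ^ 2 ≤ ‖z‖ ^ 2 * ‖u‖ ^ 2 := by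
    rw [← mul_pow]
    gcongr
  rcases le_total 0 (deriv (deriv f) (‖z‖ ^ 2)) with h | h
  · have := mul_nonneg h (sq_nonneg ‖∑ j, conj (z j) * u j‖)
    have := mul_pos h1 hu'
    linarith
  · have := mul_le_mul_of_nonpos_left hcs2 h
    have := mul_pos h2 hu'
    nlinarith

theorem contDiffAt_norm_sq {m : WithTop ℕ∞} (z : Cn n) :
    ContDiffAt ℝ m (fun y : Cn n => ‖y‖ ^ 2) z :=
  (contDiff_norm_sq ℂ).contDiffAt

theorem analyticAt_radialPotential {f : ℝ → ℝ} {z : Cn n} (hf : AnalyticAt ℝ f (‖z‖ ^ 2)) :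
    AnalyticAt ℝ (radialPotential n f) z :=
  hf.comp (f := fun y : Cn n => ‖y‖ ^ 2) (contDiffAt_norm_sq z).analyticAt

/-- A property that holds for all reals near `0` holds at `|z|²` for all `z` in a small ball. -/
theorem exists_ball_norm_sq {p : ℝ → Prop} (hp : ∀ᶠ x in 𝓝 (0 : ℝ), p x) :
    ∃ R : ℝ, 0 < R ∧ ∀ z ∈ Metric.ball (0 : Cn n) R, p (‖z‖ ^ 2) := by
  have hc : Tendsto (fun y : Cn n => ‖y‖ ^ 2) (𝓝 0) (𝓝 0) := by
    have : Continuous fun y : Cn n => ‖y‖ ^ 2 := by fun_prop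
    simpa using this.tendsto 0
  obtain ⟨R, hR, h⟩ := Metric.eventually_nhds_iff_ball.1 (hc.eventually hp)
  exact ⟨R, hR, h⟩

theorem eventually_isKahlerPotential {f : ℝ → ℝ} (hf : AnalyticAt ℝ f 0) (h0 : 0 < deriv f 0) :
    ∀ᶠ x in 𝓝 (0 : ℝ), AnalyticAt ℝ f x ∧ 0 < deriv f x ∧
      0 < deriv f x + x * deriv (deriv f) x := by
  have c1 : ContinuousAt (deriv f) 0 := hf.deriv.continuousAt
  have c2 : ContinuousAt (deriv (deriv f)) 0 := hf.deriv.deriv.continuousAt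
  have c3 : ContinuousAt (fun x => deriv f x + x * deriv (deriv f) x) 0 :=
    c1.add (continuousAt_id.mul c2)
  refine hf.eventually_analyticAt.and ((c1.eventually_const_lt h0).and
    (c3.eventually_const_lt ?_))
  simpa using h0

theorem isKahlerPotentialOn_radialPotential {f : ℝ → ℝ} {R : ℝ}
    (h : ∀ z ∈ Metric.ball (0 : Cn n) R, AnalyticAt ℝ f (‖z‖ ^ 2) ∧ 0 < deriv f (‖z‖ ^ 2) ∧
      0 < deriv f (‖z‖ ^ 2) + ‖z‖ ^ 2 * deriv (deriv f) (‖z‖ ^ 2)) :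
    IsKahlerPotentialOn (radialPotential n f) (Metric.ball 0 R) :=
  ⟨fun z hz => analyticAt_radialPotential (h z hz).1, fun z hz _ hu =>
    leviForm_radialPotential_pos (h z hz).1 (h z hz).2.1 (h z hz).2.2 hu⟩

/-- The Kähler form of `f(|z|²)` is `(i/2) (f' ∑ dz_j ∧ dz̄_j + f'' α ∧ ᾱ)` with
`α = ∑ z̄_j dz_j`. -/
theorem kahlerForm_radialPotential {f : ℝ → ℝ} {z : Cn n} (hf : AnalyticAt ℝ f (‖z‖ ^ 2))
    (u v : Cn n) :
    kahlerForm (radialPotential n f) z u v = (Complex.I / 2) *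
      (((deriv f (‖z‖ ^ 2) : ℝ) : ℂ) * (∑ j, u j * conj (v j) - ∑ j, v j * conj (u j)) +
        ((deriv (deriv f) (‖z‖ ^ 2) : ℝ) : ℂ) *
          ((∑ j, conj (z j) * u j) * (∑ j, z j * conj (v j)) -
            (∑ j, conj (z j) * v j) * ∑ j, z j * conj (u j))) := by
  simp only [kahlerForm, mul_sub, Finset.sum_sub_distrib, sum_leviMatrix_radialPotential hf]
  ring

/-! ### The dual potential -/

/-- The profile `x ↦ -f(-x)` of the dual of the radial potential `f(|z|²)`: replacing `z̄` by `-z̄`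
turns `|z|²` into `-|z|²`. -/
def dualProfile (f : ℝ → ℝ) (x : ℝ) : ℝ := -f (-x)

theorem deriv_dualProfile (f : ℝ → ℝ) (x : ℝ) : deriv (dualProfile f) x = deriv f (-x) := by
  have h : dualProfile f = fun x => -(fun y => f (-y)) x := rfl
  rw [h, deriv.fun_neg, deriv_comp_neg, neg_neg]

theorem dualProfile_dualProfile (f : ℝ → ℝ) : dualProfile (dualProfile f) = f := by
  ext x
  simp [dualProfile]

theorem analyticAt_dualProfile {f : ℝ → ℝ} (hf : AnalyticAt ℝ f 0) :
    AnalyticAt ℝ (dualProfile f) 0 := by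
  have h : AnalyticAt ℝ f (-(0 : ℝ)) := by simpa using hf
  exact (h.comp (f := fun x : ℝ => -x) analyticAt_id.neg).neg

/-- A real analytic function of one variable extends to a complex analytic one, by the same power
series. -/
theorem exists_complex_extension {f : ℝ → ℝ} (hf : AnalyticAt ℝ f 0) :
    ∃ F : ℂ → ℂ, AnalyticAt ℂ F 0 ∧ ∀ᶠ x : ℝ in 𝓝 0, (f x : ℂ) = F x := by
  obtain ⟨p, r, hp⟩ := hf
  set q : FormalMultilinearSeries ℂ ℂ ℂ :=
    FormalMultilinearSeries.ofScalars ℂ fun k => (p.coeff k : ℂ) with hq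
  have hnorm : ∀ k, ‖q k‖ = ‖p k‖ := fun k => by
    rw [hq, FormalMultilinearSeries.ofScalars_norm, Complex.norm_real,
      FormalMultilinearSeries.norm_apply_eq_norm_coef]
  have hrad : r ≤ q.radius := by
    refine hp.r_le.trans (ENNReal.le_of_forall_nnreal_lt fun s hs => ?_)
    refine q.le_radius_of_summable_norm ?_
    simpa only [hnorm] using p.summable_norm_mul_pow hs
  have hsum := q.hasFPowerSeriesOnBall (hp.r_pos.trans_le hrad)
  refine ⟨q.sum, hsum.analyticAt, ?_⟩
  filter_upwards [Metric.eball_mem_nhds (0 : ℝ) hp.r_pos] with x hx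
  have h1 := hp.hasSum hx
  have hx' : (x : ℂ) ∈ Metric.eball (0 : ℂ) q.radius := by
    refine Metric.mem_eball.2 (lt_of_lt_of_le ?_ hrad)
    simpa [edist_zero_right, enorm] using hx
  have h2 := hsum.hasSum hx'
  rw [zero_add] at h1 h2
  have h3 : ∀ k, ((p k fun _ => x : ℝ) : ℂ) = q k fun _ => (x : ℂ) := fun k => by
    rw [FormalMultilinearSeries.apply_eq_pow_smul_coeff, hq,
      FormalMultilinearSeries.ofScalars_apply_eq]
    simp [mul_comm]
  simp only [← h3] at h2
  exact (Complex.hasSum_ofReal.2 h1).unique h2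

theorem isLocalDual_radialPotential {f : ℝ → ℝ} (hf : AnalyticAt ℝ f 0) {R : ℝ} (hR : 0 < R)
    (hK : IsKahlerPotentialOn (radialPotential n (dualProfile f)) (Metric.ball 0 R)) :
    IsLocalDual (radialPotential n f) (Metric.ball 0 R) (radialPotential n (dualProfile f)) := by
  refine ⟨Metric.isOpen_ball, ⟨⟨0, Metric.mem_ball_self hR⟩,
    (convex_ball 0 R).isPreconnected⟩, Metric.mem_ball_self hR, hK, ?_⟩
  obtain ⟨F, hF, hfF⟩ := exists_complex_extension hf
  have hc : Tendsto (fun z : Cn n => ‖z‖ ^ 2) (𝓝 0) (𝓝 0) := by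
    have : Continuous fun y : Cn n => ‖y‖ ^ 2 := by fun_prop
    simpa using this.tendsto 0
  have hc' : Tendsto (fun z : Cn n => -‖z‖ ^ 2) (𝓝 0) (𝓝 0) := by
    simpa using hc.neg
  refine ⟨fun w => F (∑ j, w.1 j * w.2 j), ?_, ?_, ?_⟩
  · have h1 : AnalyticAt ℂ (fun w : (Fin n → ℂ) × (Fin n → ℂ) => ∑ j, w.1 j * w.2 j) 0 := by
      refine Finset.analyticAt_fun_sum _ fun j _ => AnalyticAt.fun_mul ?_ ?_
      · exact ((ContinuousLinearMap.proj j : (Fin n → ℂ) →L[ℂ] ℂ).comp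
          (ContinuousLinearMap.fst ℂ (Fin n → ℂ) (Fin n → ℂ))).analyticAt _
      · exact ((ContinuousLinearMap.proj j : (Fin n → ℂ) →L[ℂ] ℂ).comp
          (ContinuousLinearMap.snd ℂ (Fin n → ℂ) (Fin n → ℂ))).analyticAt _
    refine AnalyticAt.comp (g := F) ?_ h1
    simpa using hF
  · filter_upwards [hc.eventually hfF] with z hz
    rw [radialPotential, hz, ofReal_norm_sq]
  · filter_upwards [hc'.eventually hfF] with z hz
    simp only [radialPotential, dualProfile, Complex.ofReal_neg]
    rw [hz, Complex.ofReal_neg, ofReal_norm_sq]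
    simp only [mul_neg, Finset.sum_neg_distrib]

/-! ### The symplectic duality -/

/-- The radial map `z ↦ √(lam f'(|z|²)) z`, which pulls the flat form back to `lam` times the
Kähler form of `f(|z|²)`. -/
noncomputable def radialDarbouxMap (lam : ℝ) (f : ℝ → ℝ) (z : Cn n) : Cn n :=
  √(lam * deriv f (‖z‖ ^ 2)) • z

theorem contDiffAt_radialDarbouxMap {lam : ℝ} {f : ℝ → ℝ} {z : Cn n}
    (hf : AnalyticAt ℝ f (‖z‖ ^ 2)) (h0 : 0 < lam * deriv f (‖z‖ ^ 2)) :
    ContDiffAt ℝ ∞ (radialDarbouxMap lam f : Cn n → Cn n) z := by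
  have h1 : ContDiffAt ℝ ∞ (fun y : Cn n => lam * deriv f (‖y‖ ^ 2)) z :=
    contDiffAt_const.mul (hf.deriv.contDiffAt.comp z (contDiffAt_norm_sq z))
  exact (h1.sqrt h0.ne').smul contDiffAt_id

theorem fderiv_radialDarbouxMap {lam : ℝ} {f : ℝ → ℝ} {z : Cn n}
    (hf : AnalyticAt ℝ f (‖z‖ ^ 2)) (h0 : 0 < lam * deriv f (‖z‖ ^ 2)) (u : Cn n) (j : Fin n) :
    fderiv ℝ (radialDarbouxMap lam f : Cn n → Cn n) z u j =
      (√(lam * deriv f (‖z‖ ^ 2)) : ℝ) * u j +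
        ((lam * deriv (deriv f) (‖z‖ ^ 2) / (2 * √(lam * deriv f (‖z‖ ^ 2))) : ℝ) : ℂ) *
          (∑ k, conj (z k) * u k + ∑ k, z k * conj (u k)) * z j := by
  obtain ⟨L, hL, hu⟩ := hasFDerivAt_norm_sq z
  have h1 : HasDerivAt (fun x => √(lam * deriv f x))
      (lam * deriv (deriv f) (‖z‖ ^ 2) / (2 * √(lam * deriv f (‖z‖ ^ 2)))) (‖z‖ ^ 2) :=
    (hf.deriv.differentiableAt.hasDerivAt.const_mul lam).sqrt h0.ne'
  have h2 := (h1.comp_hasFDerivAt z hL).smul (hasFDerivAt_id z)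
  have h3 : fderiv ℝ (radialDarbouxMap lam f : Cn n → Cn n) z = _ := h2.fderiv
  rw [h3]
  simp [← Finset.sum_add_distrib, ← hu]

/-- With `a = √(lam f')` the map `z ↦ a(|z|²) z` pulls `∑ dz_j ∧ dz̄_j` back to
`a² ∑ dz_j ∧ dz̄_j + (a²)' α ∧ ᾱ`, where `α = ∑ z̄_j dz_j`. -/
theorem flatForm_fderiv_radialDarbouxMap {lam : ℝ} {f : ℝ → ℝ} {z : Cn n}
    (hf : AnalyticAt ℝ f (‖z‖ ^ 2)) (h0 : 0 < lam * deriv f (‖z‖ ^ 2)) (u v : Cn n) :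
    flatForm (fderiv ℝ (radialDarbouxMap lam f : Cn n → Cn n) z u)
        (fderiv ℝ (radialDarbouxMap lam f : Cn n → Cn n) z v) =
      (lam : ℂ) * kahlerForm (radialPotential n f) z u v := by
  rw [kahlerForm_radialPotential hf, flatForm]
  simp only [fderiv_radialDarbouxMap hf h0]
  set a : ℝ := √(lam * deriv f (‖z‖ ^ 2)) with ha
  set b : ℝ := lam * deriv (deriv f) (‖z‖ ^ 2) / (2 * a) with hb
  have ha0 : a ≠ 0 := (Real.sqrt_pos.2 h0).ne'
  have haa : (a : ℂ) * a = lam * (deriv f (‖z‖ ^ 2) : ℝ) := by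
    exact_mod_cast Real.mul_self_sqrt h0.le
  have hab : 2 * (a : ℂ) * b = lam * (deriv (deriv f) (‖z‖ ^ 2) : ℝ) := by
    have : 2 * a * b = lam * deriv (deriv f) (‖z‖ ^ 2) := by
      rw [hb]
      field_simp
    exact_mod_cast this
  set αu := ∑ k, conj (z k) * u k with hαu
  set αv := ∑ k, conj (z k) * v k with hαv
  set βu := ∑ k, z k * conj (u k) with hβu
  set βv := ∑ k, z k * conj (v k) with hβv
  have cαu : conj αu = βu := by simp [hαu, hβu]
  have cαv : conj αv = βv := by simp [hαv, hβv]
  have cβu : conj βu = αu := by simp [hαu, hβu]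
  have cβv : conj βv = αv := by simp [hαv, hβv]
  have key : ∀ j, ((a : ℂ) * u j + b * (αu + βu) * z j) * conj ((a : ℂ) * v j + b * (αv + βv) * z j)
      - ((a : ℂ) * v j + b * (αv + βv) * z j) * conj ((a : ℂ) * u j + b * (αu + βu) * z j)
      = a * a * (u j * conj (v j)) - a * a * (v j * conj (u j))
        + a * b * ((αv + βv) * (conj (z j) * u j)) - a * b * ((αv + βv) * (z j * conj (u j)))
        + a * b * ((αu + βu) * (z j * conj (v j))) - a * b * ((αu + βu) * (conj (z j) * v j)) := by
    intro j
    simp only [map_add, map_mul, Complex.conj_ofReal, cαu, cαv, cβu, cβv]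
    ring
  simp only [key, Finset.sum_add_distrib, Finset.sum_sub_distrib, ← Finset.mul_sum, ← hαu, ← hαv,
    ← hβu, ← hβv]
  linear_combination (Complex.I / 2) *
      (∑ j, u j * conj (v j) - ∑ j, v j * conj (u j)) * haa +
    (Complex.I / 2) * (αu * βv - αv * βu) * hab

/-- The duality equation at `|z|²` says that the radial map of the dual profile undoes the radial map
of `f` at `z`: the product of the two scaling factors is `√(lam² f'(r) f'(-lam r f'(r)))`. -/
theorem radialDarbouxMap_dualProfile {lam : ℝ} (hlam : 0 < lam) {f : ℝ → ℝ} {z : Cn n}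
    (h0 : 0 < deriv f (‖z‖ ^ 2))
    (h : lam ^ 2 * deriv f (‖z‖ ^ 2) * deriv f (-lam * ‖z‖ ^ 2 * deriv f (‖z‖ ^ 2)) = 1) :
    radialDarbouxMap lam (dualProfile f) (radialDarbouxMap lam f z) = z := by
  have h1 : 0 ≤ lam * deriv f (‖z‖ ^ 2) := by positivity
  have h2 : ‖(radialDarbouxMap lam f z : Cn n)‖ ^ 2 = lam * deriv f (‖z‖ ^ 2) * ‖z‖ ^ 2 := by
    rw [radialDarbouxMap, norm_smul, mul_pow, Real.norm_eq_abs, sq_abs, Real.sq_sqrt h1]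
  have h3 : -(lam * deriv f (‖z‖ ^ 2) * ‖z‖ ^ 2) = -lam * ‖z‖ ^ 2 * deriv f (‖z‖ ^ 2) := by ring
  rw [radialDarbouxMap, h2, deriv_dualProfile, h3, radialDarbouxMap, smul_smul,
    mul_comm, ← Real.sqrt_mul h1]
  have h4 : lam * deriv f (‖z‖ ^ 2) *
      (lam * deriv f (-lam * ‖z‖ ^ 2 * deriv f (‖z‖ ^ 2))) = 1 := by
    linear_combination h
  rw [h4, Real.sqrt_one, one_smul]

theorem radialDualityEquation_dualProfile {lam : ℝ} {f : ℝ → ℝ}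
    (h : RadialDualityEquation lam f) : RadialDualityEquation lam (dualProfile f) := by
  have hneg : Tendsto (fun x : ℝ => -x) (𝓝 0) (𝓝 0) := by
    simpa using (continuous_neg (G := ℝ)).tendsto 0
  filter_upwards [hneg.eventually h] with x hx
  rw [deriv_dualProfile, deriv_dualProfile, ← hx]
  congr 2
  ring

/-- If `f' > 0` at `0`, the radial duality equation yields a duality: `z ↦ √(lam f'(|z|²)) z` and
the analogous map of the dual potential are mutually inverse, and each of them pulls the flat form
back to `lam` times the Kähler form at its source. -/
theorem admitsSymplecticDuality_radialPotential {lam : ℝ} (hlam : 0 < lam) {f : ℝ → ℝ}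
    (hf : AnalyticAt ℝ f 0) (h0 : 0 < deriv f 0) (h : RadialDualityEquation lam f) {R : ℝ}
    (hR : 0 < R) :
    AdmitsSymplecticDuality lam (Metric.ball 0 R) (radialPotential n f) := by
  have hf' := analyticAt_dualProfile hf
  have h0' : 0 < deriv (dualProfile f) 0 := by simpa [deriv_dualProfile] using h0
  obtain ⟨r, hr, H⟩ := exists_ball_norm_sq (n := n)
    ((eventually_isKahlerPotential hf h0).and h)
  obtain ⟨s, hs, H'⟩ := exists_ball_norm_sq (n := n)
    ((eventually_isKahlerPotential hf' h0').and (radialDualityEquation_dualProfile h))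
  set Ψ : Cn n → Cn n := radialDarbouxMap lam f with hΨ
  set Θ : Cn n → Cn n := radialDarbouxMap lam (dualProfile f) with hΘ
  set B : Set (Cn n) := Metric.ball 0 (min r R) with hB
  set B' : Set (Cn n) := Metric.ball 0 s with hB'
  have hBr : B ⊆ Metric.ball 0 r := Metric.ball_subset_ball (min_le_left _ _)
  have dΨ : ∀ z ∈ B, ContDiffAt ℝ ∞ Ψ z := fun z hz =>
    contDiffAt_radialDarbouxMap (H z (hBr hz)).1.1 (mul_pos hlam (H z (hBr hz)).1.2.1)
  have dΘ : ∀ z ∈ B', ContDiffAt ℝ ∞ Θ z := fun z hz =>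
    contDiffAt_radialDarbouxMap (H' z hz).1.1 (mul_pos hlam (H' z hz).1.2.1)
  have hΘΨ : ∀ z ∈ B, Θ (Ψ z) = z := fun z hz =>
    radialDarbouxMap_dualProfile hlam (H z (hBr hz)).1.2.1 (H z (hBr hz)).2
  have hΨΘ : ∀ z ∈ B', Ψ (Θ z) = z := fun z hz => by
    have := radialDarbouxMap_dualProfile hlam (H' z hz).1.2.1 (H' z hz).2
    rwa [dualProfile_dualProfile] at this
  have cΨ : ContinuousOn Ψ B := fun z hz => (dΨ z hz).continuousAt.continuousWithinAt
  have cΘ : ContinuousOn Θ B' := fun z hz => (dΘ z hz).continuousAt.continuousWithinAt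
  have hΨ0 : Ψ 0 = 0 := smul_zero _
  have hΘ0 : Θ 0 = 0 := smul_zero _
  have zB : (0 : Cn n) ∈ B := Metric.mem_ball_self (lt_min hr hR)
  have zB' : (0 : Cn n) ∈ B' := Metric.mem_ball_self hs
  refine ⟨B', radialPotential n (dualProfile f),
    { toFun := Ψ
      invFun := Θ
      source := B ∩ Ψ ⁻¹' B'
      target := B' ∩ Θ ⁻¹' B
      map_source' := fun z hz => ⟨hz.2, by rw [Set.mem_preimage, hΘΨ z hz.1]; exact hz.1⟩
      map_target' := fun z hz => ⟨hz.2, by rw [Set.mem_preimage, hΨΘ z hz.1]; exact hz.1⟩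
      left_inv' := fun z hz => hΘΨ z hz.1
      right_inv' := fun z hz => hΨΘ z hz.1
      open_source := cΨ.isOpen_inter_preimage Metric.isOpen_ball Metric.isOpen_ball
      open_target := cΘ.isOpen_inter_preimage Metric.isOpen_ball Metric.isOpen_ball
      continuousOn_toFun := cΨ.mono Set.inter_subset_left
      continuousOn_invFun := cΘ.mono Set.inter_subset_left },
    isLocalDual_radialPotential hf hs
      (isKahlerPotentialOn_radialPotential fun z hz => (H' z hz).1),
    { lam_pos := hlam
      source_subset := fun z hz => Metric.ball_subset_ball (min_le_right _ _) hz.1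
      target_subset := fun z hz => hz.1
      zero_mem_source := ⟨zB, by rw [Set.mem_preimage, hΨ0]; exact zB'⟩
      zero_mem_target := ⟨zB', by rw [Set.mem_preimage, hΘ0]; exact zB⟩
      contDiffOn := fun z hz => (dΨ z hz.1).contDiffWithinAt
      contDiffOn_symm := fun z hz => (dΘ z hz.1).contDiffWithinAt
      pullback_flat := fun z hz u v => flatForm_fderiv_radialDarbouxMap (H z (hBr hz.1)).1.1
        (mul_pos hlam (H z (hBr hz.1)).1.2.1) u v
      pullback_dual := ?_ }⟩
  intro z hz u v
  change (lam : ℂ) * kahlerForm (radialPotential n (dualProfile f)) (Ψ z) (fderiv ℝ Ψ z u)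
    (fderiv ℝ Ψ z v) = flatForm u v
  have hz' : Ψ z ∈ B' := hz.2
  rw [← flatForm_fderiv_radialDarbouxMap (H' _ hz').1.1 (mul_pos hlam (H' _ hz').1.2.1)]
  -- the differentials of the two maps are inverse to each other
  have hd : HasFDerivAt (fun y => Θ (Ψ y)) ((fderiv ℝ Θ (Ψ z)).comp (fderiv ℝ Ψ z)) z :=
    ((dΘ _ hz').differentiableAt (by simp)).hasFDerivAt.comp z
      ((dΨ z hz.1).differentiableAt (by simp)).hasFDerivAt
  have hid : (fun y => Θ (Ψ y)) =ᶠ[𝓝 z] fun y => y := by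
    filter_upwards [Metric.isOpen_ball.mem_nhds hz.1] with y hy
    exact hΘΨ y hy
  have hcomp := hd.unique ((hasFDerivAt_id z).congr_of_eventuallyEq hid)
  have hcomp' : ∀ w, fderiv ℝ Θ (Ψ z) (fderiv ℝ Ψ z w) = w := fun w => DFunLike.congr_fun hcomp w
  rw [← hΘ, hcomp', hcomp']

/-! ### The radial holomorphic sectional curvature -/

theorem det_leviMatrix_ne_zero {Φ : Cn n → ℝ} {z : Cn n}
    (h : ∀ u : Cn n, u ≠ 0 → 0 < leviForm Φ z u) : (leviMatrix Φ z).det ≠ 0 := by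
  intro hdet
  obtain ⟨v, hv, hv0⟩ := Matrix.exists_mulVec_eq_zero_iff.2 hdet
  have hu : WithLp.toLp 2 (fun j => conj (v j)) ≠ (0 : Cn n) := by
    intro h0
    refine hv (funext fun j => ?_)
    have := congrArg (fun w : Cn n => w j) h0
    simpa using this
  have hpos := h _ hu
  have hzero : ∀ j, ∑ k, leviMatrix Φ z j k * v k = 0 := fun j => congrFun hv0 j
  have : leviForm Φ z (WithLp.toLp 2 (fun j => conj (v j)) : Cn n) = 0 := by
    rw [leviForm]
    have : ∀ j, ∑ k, leviMatrix Φ z j k * (conj (v j) * conj (conj (v k))) = 0 := fun j => by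
      calc _ = conj (v j) * ∑ k, leviMatrix Φ z j k * v k := by
            rw [Finset.mul_sum]
            exact Finset.sum_congr rfl fun k _ => by rw [Complex.conj_conj]; ring
        _ = 0 := by rw [hzero, mul_zero]
    exact (congrArg Complex.re (Finset.sum_eq_zero fun j _ => this j)).trans Complex.zero_re
  exact hpos.ne' this

theorem hasWirtingerAt_leviMatrix_radialPotential {f : ℝ → ℝ} {z : Cn n}
    (hf : AnalyticAt ℝ f (‖z‖ ^ 2)) (i j : Fin n) :
    HasWirtingerAt (fun y => leviMatrix (radialPotential n f) y i j)
      (fun k => ((deriv (deriv f) (‖z‖ ^ 2) : ℝ) : ℂ) *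
          (conj (z k) * (if i = j then 1 else 0) + conj (z i) * (if k = j then 1 else 0)) +
        ((deriv (deriv (deriv f)) (‖z‖ ^ 2) : ℝ) : ℂ) * (conj (z k) * (conj (z i) * z j)))
      (fun l => ((deriv (deriv f) (‖z‖ ^ 2) : ℝ) : ℂ) *
          (z l * (if i = j then 1 else 0) + (if l = i then 1 else 0) * z j) +
        ((deriv (deriv (deriv f)) (‖z‖ ^ 2) : ℝ) : ℂ) * (z l * (conj (z i) * z j)))
      z := by
  have h1 := (hasWirtingerAt_radial hf.deriv.differentiableAt.hasDerivAt).mul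
    (hasWirtingerAt_const (if i = j then 1 else 0) z)
  have h2 := (hasWirtingerAt_radial hf.deriv.deriv.differentiableAt.hasDerivAt).mul
    ((hasWirtingerAt_conj_coord i z).mul (hasWirtingerAt_coord j z))
  refine (h1.add h2).congr ?_ (fun k => by ring) (fun l => by ring)
  filter_upwards [eventually_analyticAt_norm_sq hf] with y hy
  exact leviMatrix_radialPotential hy i j

theorem dz_dzbar_leviMatrix_radialPotential {f : ℝ → ℝ} {z : Cn n}
    (hf : AnalyticAt ℝ f (‖z‖ ^ 2)) (i j k l : Fin n) :
    dz k (fun y => dzbar l (fun x => leviMatrix (radialPotential n f) x i j) y) z =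
      ((deriv (deriv f) (‖z‖ ^ 2) : ℝ) : ℂ) *
          ((if k = l then 1 else 0) * (if i = j then 1 else 0) +
            (if l = i then 1 else 0) * (if k = j then 1 else 0)) +
        ((deriv (deriv (deriv f)) (‖z‖ ^ 2) : ℝ) : ℂ) *
          (conj (z k) * (z l * (if i = j then 1 else 0) + (if l = i then 1 else 0) * z j) +
            (if k = l then 1 else 0) * (conj (z i) * z j) +
            z l * (conj (z i) * (if k = j then 1 else 0))) +
        ((deriv (deriv (deriv (deriv f))) (‖z‖ ^ 2) : ℝ) : ℂ) *
          (conj (z k) * (z l * (conj (z i) * z j))) := by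
  have h1 := (hasWirtingerAt_radial hf.deriv.deriv.differentiableAt.hasDerivAt).mul
    (((hasWirtingerAt_coord l z).mul (hasWirtingerAt_const (if i = j then 1 else 0) z)).add
      ((hasWirtingerAt_const (if l = i then 1 else 0) z).mul (hasWirtingerAt_coord j z)))
  have h2 := (hasWirtingerAt_radial hf.deriv.deriv.deriv.differentiableAt.hasDerivAt).mul
    ((hasWirtingerAt_coord l z).mul
      ((hasWirtingerAt_conj_coord i z).mul (hasWirtingerAt_coord j z)))
  have h3 := (h1.add h2).congr
    (G := fun y => dzbar l (fun x => leviMatrix (radialPotential n f) x i j) y) ?_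
    (fun _ => rfl) (fun _ => rfl)
  · rw [h3.dz_eq]
    ring
  · filter_upwards [eventually_analyticAt_norm_sq hf] with y hy
    exact (hasWirtingerAt_leviMatrix_radialPotential hy i j).dzbar_eq l

theorem sum_linear_add_single (A B : ℂ) (k : Fin n) (w v : Fin n → ℂ) :
    ∑ l, (A * w l + B * (if l = k then 1 else 0)) * v l = A * ∑ l, w l * v l + B * v k := by
  simp only [add_mul, Finset.sum_add_distrib, Finset.mul_sum]
  congr 1
  · exact Finset.sum_congr rfl fun l _ => by ring
  · simp

theorem sum_linear_add_single_add_single (A B C : ℂ) (k i : Fin n) (w v : Fin n → ℂ) :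
    ∑ l, (A * w l + B * (if l = k then 1 else 0) + C * (if l = i then 1 else 0)) * v l =
      A * ∑ l, w l * v l + B * v k + C * v i := by
  rw [← sum_linear_add_single]
  simp only [add_mul, Finset.sum_add_distrib]
  congr 1
  simp

theorem sum_dz_leviMatrix_radialPotential {f : ℝ → ℝ} {z : Cn n}
    (hf : AnalyticAt ℝ f (‖z‖ ^ 2)) (q : Fin n) :
    ∑ i, (∑ k, dz k (fun x => leviMatrix (radialPotential n f) x i q) z * z k) * z i =
      ((‖z‖ ^ 2 * (2 * deriv (deriv f) (‖z‖ ^ 2) +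
        ‖z‖ ^ 2 * deriv (deriv (deriv f)) (‖z‖ ^ 2)) : ℝ) : ℂ) * z q := by
  set f2 := deriv (deriv f) (‖z‖ ^ 2) with hf2
  set f3 := deriv (deriv (deriv f)) (‖z‖ ^ 2) with hf3
  set S := ∑ j, conj (z j) * z j with hS
  have hSr : ((‖z‖ ^ 2 : ℝ) : ℂ) = S := by
    rw [ofReal_norm_sq]
    exact Finset.sum_congr rfl fun j _ => mul_comm _ _
  have h1 : ∀ i, ∑ k, dz k (fun x => leviMatrix (radialPotential n f) x i q) z * z k =
      ((f2 : ℂ) + f3 * S) * z q * conj (z i) + (f2 * S) * (if i = q then 1 else 0) := by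
    intro i
    have h := sum_linear_add_single
      ((f2 : ℂ) * (if i = q then 1 else 0) + f3 * (conj (z i) * z q))
      (f2 * conj (z i)) q (fun k => conj (z k)) (fun k => z k)
    rw [← hS] at h
    refine Eq.trans (Finset.sum_congr rfl fun k _ => ?_) (h.trans (by ring))
    rw [(hasWirtingerAt_leviMatrix_radialPotential hf i q).dz_eq]
    ring
  simp only [h1]
  rw [sum_linear_add_single, ← hS, Complex.ofReal_mul, hSr, Complex.ofReal_add,
    Complex.ofReal_mul (‖z‖ ^ 2), hSr]
  push_cast
  ring

theorem sum_dzbar_leviMatrix_radialPotential {f : ℝ → ℝ} {z : Cn n}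
    (hf : AnalyticAt ℝ f (‖z‖ ^ 2)) (p : Fin n) :
    ∑ j, (∑ l, dzbar l (fun x => leviMatrix (radialPotential n f) x p j) z * conj (z l)) *
        conj (z j) =
      ((‖z‖ ^ 2 * (2 * deriv (deriv f) (‖z‖ ^ 2) +
        ‖z‖ ^ 2 * deriv (deriv (deriv f)) (‖z‖ ^ 2)) : ℝ) : ℂ) * conj (z p) := by
  set f2 := deriv (deriv f) (‖z‖ ^ 2) with hf2
  set f3 := deriv (deriv (deriv f)) (‖z‖ ^ 2) with hf3
  set S := ∑ j, z j * conj (z j) with hS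
  have hSr : ((‖z‖ ^ 2 : ℝ) : ℂ) = S := ofReal_norm_sq z
  have h1 : ∀ j, ∑ l, dzbar l (fun x => leviMatrix (radialPotential n f) x p j) z * conj (z l) =
      ((f2 : ℂ) + f3 * S) * conj (z p) * z j + (f2 * S) * (if j = p then 1 else 0) := by
    intro j
    have h := sum_linear_add_single
      ((f2 : ℂ) * (if j = p then 1 else 0) + f3 * (conj (z p) * z j))
      (f2 * z j) p (fun l => z l) (fun l => conj (z l))
    rw [← hS] at h
    refine Eq.trans (Finset.sum_congr rfl fun l _ => ?_) (h.trans (by ring))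
    rw [(hasWirtingerAt_leviMatrix_radialPotential hf p j).dzbar_eq, if_congr eq_comm rfl rfl]
    ring
  simp only [h1]
  rw [sum_linear_add_single _ _ _ (fun j => z j), ← hS, Complex.ofReal_mul, hSr,
    Complex.ofReal_add, Complex.ofReal_mul (‖z‖ ^ 2), hSr]
  push_cast
  ring

theorem sum_dz_dzbar_leviMatrix_radialPotential {f : ℝ → ℝ} {z : Cn n}
    (hf : AnalyticAt ℝ f (‖z‖ ^ 2)) :
    ∑ i, ∑ j, ∑ k, ∑ l, dz k (fun y => dzbar l
        (fun x => leviMatrix (radialPotential n f) x i j) y) z *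
          (z i * conj (z j) * z k * conj (z l)) =
      (((‖z‖ ^ 2) ^ 2 * (2 * deriv (deriv f) (‖z‖ ^ 2) +
        4 * ‖z‖ ^ 2 * deriv (deriv (deriv f)) (‖z‖ ^ 2) +
        (‖z‖ ^ 2) ^ 2 * deriv (deriv (deriv (deriv f))) (‖z‖ ^ 2)) : ℝ) : ℂ) := by
  simp only [dz_dzbar_leviMatrix_radialPotential hf]
  set f2 := deriv (deriv f) (‖z‖ ^ 2) with hf2
  set f3 := deriv (deriv (deriv f)) (‖z‖ ^ 2) with hf3
  set f4 := deriv (deriv (deriv (deriv f))) (‖z‖ ^ 2) with hf4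
  set S := ∑ j, z j * conj (z j) with hS
  have hS' : ∑ j, conj (z j) * z j = S := Finset.sum_congr rfl fun j _ => mul_comm _ _
  have hSr : ((‖z‖ ^ 2 : ℝ) : ℂ) = S := ofReal_norm_sq z
  -- the four indices are summed one after the other, beginning with the innermost
  have h1 : ∀ i j k, ∑ l, ((f2 : ℂ) *
          ((if k = l then 1 else 0) * (if i = j then 1 else 0) +
            (if l = i then 1 else 0) * (if k = j then 1 else 0)) +
        (f3 : ℂ) *
          (conj (z k) * (z l * (if i = j then 1 else 0) + (if l = i then 1 else 0) * z j) +
            (if k = l then 1 else 0) * (conj (z i) * z j) +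
            z l * (conj (z i) * (if k = j then 1 else 0))) +
        (f4 : ℂ) * (conj (z k) * (z l * (conj (z i) * z j)))) *
          (z i * conj (z j) * z k * conj (z l)) =
      (((f3 * S + f2) * (if i = j then 1 else 0) + (f4 * S + 2 * f3) * (conj (z i) * z j)) *
          conj (z k) + (f3 * S + f2) * conj (z i) * (if k = j then 1 else 0)) *
        (z i * conj (z j) * z k) := by
    intro i j k
    have h := sum_linear_add_single_add_single
      ((f3 : ℂ) * conj (z k) * (if i = j then 1 else 0) + f4 * conj (z k) * (conj (z i) * z j) +
        f3 * conj (z i) * (if k = j then 1 else 0))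
      (f2 * (if i = j then 1 else 0) + f3 * (conj (z i) * z j))
      (f3 * conj (z k) * z j + f2 * (if k = j then 1 else 0)) k i
      (fun l => z l) (fun l => z i * conj (z j) * z k * conj (z l))
    have hl : ∑ l, z l * (z i * conj (z j) * z k * conj (z l)) = z i * conj (z j) * z k * S := by
      rw [hS, Finset.mul_sum]
      exact Finset.sum_congr rfl fun l _ => by ring
    rw [hl] at h
    refine Eq.trans (Finset.sum_congr rfl fun l _ => ?_) (h.trans (by ring))
    rw [if_congr (eq_comm (a := k) (b := l)) rfl rfl]
    ring
  simp only [h1]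
  have h2 : ∀ i j, ∑ k, (((f3 * S + f2) * (if i = j then 1 else 0) +
          (f4 * S + 2 * f3) * (conj (z i) * z j)) *
          conj (z k) + (f3 * S + f2) * conj (z i) * (if k = j then 1 else 0)) *
        (z i * conj (z j) * z k) =
      (((f4 * S + 2 * f3) * S + (f3 * S + f2)) * conj (z i) * z j +
        (f3 * S + f2) * S * (if j = i then 1 else 0)) * (z i * conj (z j)) := by
    intro i j
    rw [sum_linear_add_single _ _ _ (fun k => conj (z k))]
    have hk : ∑ k, conj (z k) * (z i * conj (z j) * z k) = z i * conj (z j) * S := by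
      rw [hS, Finset.mul_sum]
      exact Finset.sum_congr rfl fun k _ => by ring
    rw [hk, if_congr (eq_comm (a := i) (b := j)) rfl rfl]
    ring
  simp only [h2]
  have h3 : ∀ i, ∑ j, (((f4 * S + 2 * f3) * S + (f3 * S + f2)) * conj (z i) * z j +
        (f3 * S + f2) * S * (if j = i then 1 else 0)) * (z i * conj (z j)) =
      S * ((f4 * S + 2 * f3) * S + 2 * (f3 * S + f2)) * (z i * conj (z i)) := by
    intro i
    rw [sum_linear_add_single _ _ _ (fun j => z j)]
    have hj : ∑ j, z j * (z i * conj (z j)) = z i * S := by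
      rw [hS, Finset.mul_sum]
      exact Finset.sum_congr rfl fun j _ => by ring
    rw [hj]
    ring
  simp only [h3]
  rw [← Finset.mul_sum, ← hS]
  push_cast
  have hSr' : ((‖z‖ : ℝ) : ℂ) ^ 2 = S := by rw [← hSr]; push_cast; rfl
  rw [hSr']
  ring

theorem sum_bilinear (N : Matrix (Fin n) (Fin n) ℂ) (D E : Fin n → Fin n → ℂ) (x y : Fin n → ℂ) :
    ∑ k, ∑ l, (∑ q, ∑ p, D k q * N q p * E l p) * (x k * y l) =
      ∑ q, ∑ p, (∑ k, D k q * x k) * N q p * ∑ l, E l p * y l := by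
  have h1 : ∀ k l, (∑ q, ∑ p, D k q * N q p * E l p) = D k ⬝ᵥ N *ᵥ E l := fun k l => by
    simp only [dotProduct, Matrix.mulVec, Finset.mul_sum, mul_assoc]
  have h2 : (∑ q, ∑ p, (∑ k, D k q * x k) * N q p * ∑ l, E l p * y l) =
      (∑ k, x k • D k) ⬝ᵥ N *ᵥ (∑ l, y l • E l) := by
    simp only [dotProduct, Matrix.mulVec, Finset.mul_sum, mul_assoc, Finset.sum_apply,
      Pi.smul_apply, smul_eq_mul, mul_comm (x _), mul_comm (y _)]
  simp only [h1, h2, Matrix.mulVec_sum, dotProduct_sum, sum_dotProduct, Matrix.mulVec_smul,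
    smul_dotProduct, dotProduct_smul, smul_eq_mul]
  rw [Finset.sum_comm]
  refine Finset.sum_congr rfl fun l _ => ?_
  rw [Finset.mul_sum]
  exact Finset.sum_congr rfl fun k _ => by ring

/-- `z̄` is an eigenvector of the complex Hessian of `f(|z|²)`, with eigenvalue `f' + r f''`. -/
theorem inv_leviMatrix_radialPotential_mulVec {f : ℝ → ℝ} {z : Cn n}
    (hf : AnalyticAt ℝ f (‖z‖ ^ 2)) (h1 : 0 < deriv f (‖z‖ ^ 2))
    (h2 : 0 < deriv f (‖z‖ ^ 2) + ‖z‖ ^ 2 * deriv (deriv f) (‖z‖ ^ 2)) (q : Fin n) :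
    ∑ p, (leviMatrix (radialPotential n f) z)⁻¹ q p * conj (z p) =
      (((deriv f (‖z‖ ^ 2) + ‖z‖ ^ 2 * deriv (deriv f) (‖z‖ ^ 2))⁻¹ : ℝ) : ℂ) * conj (z q) := by
  set H := deriv f (‖z‖ ^ 2) + ‖z‖ ^ 2 * deriv (deriv f) (‖z‖ ^ 2) with hH
  set N := leviMatrix (radialPotential n f) z with hN
  have hdet : IsUnit N.det :=
    (det_leviMatrix_ne_zero fun u hu => leviForm_radialPotential_pos hf h1 h2 hu).isUnit
  have he : N *ᵥ (fun p => conj (z p)) = (H : ℂ) • fun p => conj (z p) := by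
    funext j
    have hj := sum_linear_add_single (((deriv (deriv f) (‖z‖ ^ 2) : ℝ) : ℂ) * conj (z j))
      ((deriv f (‖z‖ ^ 2) : ℝ) : ℂ) j (fun k => z k) (fun k => conj (z k))
    rw [← ofReal_norm_sq] at hj
    change ∑ k, N j k * conj (z k) = _
    refine Eq.trans (Finset.sum_congr rfl fun k _ => ?_) (hj.trans ?_)
    · rw [hN, leviMatrix_radialPotential hf, if_congr eq_comm rfl rfl]
      ring
    · rw [hH, Pi.smul_apply, smul_eq_mul]
      push_cast
      ring
  have hH0 : (H : ℂ) ≠ 0 := by exact_mod_cast h2.ne'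
  have hinv : N⁻¹ *ᵥ (fun p => conj (z p)) = (H : ℂ)⁻¹ • fun p => conj (z p) := by
    rw [eq_inv_smul_iff₀ hH0, ← Matrix.mulVec_smul, ← he, Matrix.mulVec_mulVec,
      Matrix.nonsing_inv_mul _ hdet, Matrix.one_mulVec]
  rw [Complex.ofReal_inv]
  exact congrFun hinv q

/-- The curvature of the complex line through `z`, a totally geodesic surface whose metric has the
conformal factor `h(r) = (r f'(r))'`: it is `-2 (r (log h)')' / h`, at `r = |z|²`. -/
theorem holomorphicSectionalCurvature_radialPotential {f : ℝ → ℝ} {z : Cn n} (hz : z ≠ 0)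
    (hf : AnalyticAt ℝ f (‖z‖ ^ 2)) (h1 : 0 < deriv f (‖z‖ ^ 2)) {h h' h'' : ℝ}
    (hh : deriv f (‖z‖ ^ 2) + ‖z‖ ^ 2 * deriv (deriv f) (‖z‖ ^ 2) = h) (hpos : 0 < h)
    (hh' : 2 * deriv (deriv f) (‖z‖ ^ 2) + ‖z‖ ^ 2 * deriv (deriv (deriv f)) (‖z‖ ^ 2) = h')
    (hh'' : 3 * deriv (deriv (deriv f)) (‖z‖ ^ 2) +
      ‖z‖ ^ 2 * deriv (deriv (deriv (deriv f))) (‖z‖ ^ 2) = h'') :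
    holomorphicSectionalCurvature (radialPotential n f) z z =
      2 * (-(h' + ‖z‖ ^ 2 * h'') + ‖z‖ ^ 2 * h' ^ 2 / h) / h ^ 2 := by
  have hsecond : ∑ i, ∑ j, ∑ k, ∑ l,
      (∑ q, ∑ p, dz k (fun x => leviMatrix (radialPotential n f) x i q) z *
        (leviMatrix (radialPotential n f) z)⁻¹ q p *
        dzbar l (fun x => leviMatrix (radialPotential n f) x p j) z) *
          (z i * conj (z j) * z k * conj (z l)) =
      (((‖z‖ ^ 2 * h') ^ 2 * ‖z‖ ^ 2 / h : ℝ) : ℂ) := by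
    have e1 : ∀ i j, ∑ k, ∑ l,
        (∑ q, ∑ p, dz k (fun x => leviMatrix (radialPotential n f) x i q) z *
          (leviMatrix (radialPotential n f) z)⁻¹ q p *
          dzbar l (fun x => leviMatrix (radialPotential n f) x p j) z) *
            (z i * conj (z j) * z k * conj (z l)) =
        (∑ q, ∑ p, (∑ k, dz k (fun x => leviMatrix (radialPotential n f) x i q) z * z k) *
          (leviMatrix (radialPotential n f) z)⁻¹ q p *
          ∑ l, dzbar l (fun x => leviMatrix (radialPotential n f) x p j) z * conj (z l)) *
            (z i * conj (z j)) := by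
      intro i j
      rw [← sum_bilinear _
        (fun k q => dz k (fun x => leviMatrix (radialPotential n f) x i q) z)
        (fun l p => dzbar l (fun x => leviMatrix (radialPotential n f) x p j) z)
        (fun k => z k) (fun l => conj (z l)), Finset.sum_mul]
      refine Finset.sum_congr rfl fun k _ => ?_
      rw [Finset.sum_mul]
      exact Finset.sum_congr rfl fun l _ => by ring
    simp only [e1]
    rw [sum_bilinear _
      (fun i q => ∑ k, dz k (fun x => leviMatrix (radialPotential n f) x i q) z * z k)
      (fun j p => ∑ l, dzbar l (fun x => leviMatrix (radialPotential n f) x p j) z * conj (z l))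
      (fun i => z i) (fun j => conj (z j))]
    simp only [sum_dz_leviMatrix_radialPotential hf, sum_dzbar_leviMatrix_radialPotential hf, hh']
    have e2 : ∀ q, ∑ p, ((‖z‖ ^ 2 * h' : ℝ) : ℂ) * z q *
        (leviMatrix (radialPotential n f) z)⁻¹ q p * (((‖z‖ ^ 2 * h' : ℝ) : ℂ) * conj (z p)) =
        ((‖z‖ ^ 2 * h' : ℝ) : ℂ) ^ 2 * (h⁻¹ : ℝ) * (z q * conj (z q)) := by
      intro q
      have e3 := inv_leviMatrix_radialPotential_mulVec hf h1 (hh ▸ hpos) q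
      rw [hh] at e3
      calc _ = ((‖z‖ ^ 2 * h' : ℝ) : ℂ) ^ 2 * z q *
            ∑ p, (leviMatrix (radialPotential n f) z)⁻¹ q p * conj (z p) := by
            rw [Finset.mul_sum]
            exact Finset.sum_congr rfl fun p _ => by ring
        _ = _ := by rw [e3]; ring
    simp only [e2]
    rw [← Finset.mul_sum, ← ofReal_norm_sq]
    push_cast
    rw [div_eq_mul_inv]
    ring
  have hnum : ∑ i, ∑ j, ∑ k, ∑ l, curvatureTensor (radialPotential n f) z i j k l *
      (z i * conj (z j) * z k * conj (z l)) =
      ((-((‖z‖ ^ 2) ^ 2 * (h' + ‖z‖ ^ 2 * h'')) + (‖z‖ ^ 2 * h') ^ 2 * ‖z‖ ^ 2 / h : ℝ) : ℂ) := by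
    simp only [curvatureTensor, add_mul, neg_mul, Finset.sum_add_distrib, Finset.sum_neg_distrib]
    rw [hsecond, sum_dz_dzbar_leviMatrix_radialPotential hf, Complex.ofReal_add,
      Complex.ofReal_neg, ← hh', ← hh'']
    congr 3
    ring
  have hden : leviForm (radialPotential n f) z z = ‖z‖ ^ 2 * h := by
    have : ∑ j, conj (z j) * z j = ((‖z‖ ^ 2 : ℝ) : ℂ) := by
      rw [ofReal_norm_sq]
      exact Finset.sum_congr rfl fun j _ => mul_comm _ _
    rw [leviForm_radialPotential hf, this, Complex.norm_real, ← hh, Real.norm_eq_abs, sq_abs]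
    ring
  have hz' : ‖z‖ ≠ 0 := norm_ne_zero_iff.2 hz
  rw [holomorphicSectionalCurvature, hnum, Complex.ofReal_re, hden]
  field_simp

/-! ### The radial duality equation and involutions -/

theorem continuousAt_dualityMap {lam : ℝ} {f : ℝ → ℝ} (hf : AnalyticAt ℝ f 0) :
    ContinuousAt (dualityMap lam f) 0 :=
  (continuousAt_const.mul continuousAt_id).mul hf.deriv.continuousAt

theorem dualityMap_zero (lam : ℝ) (f : ℝ → ℝ) : dualityMap lam f 0 = 0 := by
  simp [dualityMap]

theorem tendsto_dualityMap {lam : ℝ} {f : ℝ → ℝ} (hf : AnalyticAt ℝ f 0) :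
    Tendsto (dualityMap lam f) (𝓝 0) (𝓝 0) := by
  have h := continuousAt_dualityMap (lam := lam) hf
  rwa [ContinuousAt, dualityMap_zero] at h

theorem dualityMap_dualityMap (lam : ℝ) (f : ℝ → ℝ) (x : ℝ) :
    dualityMap lam f (dualityMap lam f x) =
      x * (lam ^ 2 * deriv f x * deriv f (-lam * x * deriv f x)) := by
  simp only [dualityMap]
  ring

theorem radialDualityEquation_iff {lam : ℝ} {f : ℝ → ℝ} (hf : AnalyticAt ℝ f 0) :
    RadialDualityEquation lam f ↔
      ∀ᶠ x in 𝓝 (0 : ℝ), dualityMap lam f (dualityMap lam f x) = x := by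
  constructor
  · intro h
    filter_upwards [h] with x hx
    rw [dualityMap_dualityMap, hx, mul_one]
  · intro h
    have hne : ∀ᶠ x in 𝓝[≠] (0 : ℝ),
        lam ^ 2 * deriv f x * deriv f (-lam * x * deriv f x) = 1 := by
      filter_upwards [eventually_nhdsWithin_of_eventually_nhds h, self_mem_nhdsWithin] with x hx hx0
      rw [dualityMap_dualityMap] at hx
      exact mul_left_cancel₀ hx0 (hx.trans (mul_one x).symm)
    -- the involution gives no information at `0` itself, where the equation follows by continuity
    have hc : ContinuousAt
        (fun x => lam ^ 2 * deriv f x * deriv f (-lam * x * deriv f x)) 0 := by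
      refine (continuousAt_const.mul hf.deriv.continuousAt).mul
        (ContinuousAt.comp (g := deriv f) ?_ (continuousAt_dualityMap (lam := lam) hf))
      change ContinuousAt (deriv f) (dualityMap lam f 0)
      rw [dualityMap_zero]
      exact hf.deriv.continuousAt
    have h0 : lam ^ 2 * deriv f 0 * deriv f (-lam * 0 * deriv f 0) = 1 :=
      tendsto_nhds_unique (hc.tendsto.mono_left nhdsWithin_le_nhds)
        (tendsto_const_nhds.congr' (hne.mono fun _ hx => hx.symm))
    filter_upwards [eventually_nhdsWithin_iff.1 hne] with x hx
    rcases eq_or_ne x 0 with rfl | hx0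
    · exact h0
    · exact hx hx0

/-! ### The explicit involution -/

theorem sqrt_two_mul_self : √2 * √2 = (2 : ℝ) := Real.mul_self_sqrt (by norm_num)

theorem eventually_radicand_pos : ∀ᶠ x in 𝓝 (0 : ℝ), 0 < 2 - 8 * √2 * x := by
  have hc : ContinuousAt (fun x : ℝ => 2 - 8 * √2 * x) 0 := by fun_prop
  exact hc.eventually_const_lt (by norm_num)

theorem analyticAt_sqrt_radicand {x : ℝ} (hx : 0 < 2 - 8 * √2 * x) :
    AnalyticAt ℝ (fun y : ℝ => √(2 - 8 * √2 * y)) x := by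
  have h1 : ContDiffAt ℝ ω (fun y : ℝ => 2 - 8 * √2 * y) x := by fun_prop
  exact (h1.sqrt hx.ne').analyticAt

theorem analyticAt_explicitG : AnalyticAt ℝ explicitG 0 := by
  have h := analyticAt_sqrt_radicand (x := 0) (by norm_num)
  exact (analyticAt_const.add analyticAt_id).add (analyticAt_const.mul h)

theorem explicitG_zero : explicitG 0 = 0 := by
  simp only [explicitG, mul_zero, sub_zero]
  ring

/-- In the coordinate `t = √(2 - 8 √2 x)` the map is the reflection `t ↦ 2 √2 - t`. -/
theorem explicitG_explicitG {x : ℝ} (hx : 0 ≤ 2 - 8 * √2 * x)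
    (ht : √(2 - 8 * √2 * x) ≤ 2 * √2) : explicitG (explicitG x) = x := by
  have htt := Real.mul_self_sqrt hx
  have hs := sqrt_two_mul_self
  have hG : explicitG x = -(√2 / 2) + x + 1 / 2 * √(2 - 8 * √2 * x) := rfl
  have hroot : √(2 - 8 * √2 * explicitG x) = 2 * √2 - √(2 - 8 * √2 * x) := by
    rw [hG]
    set t := √(2 - 8 * √2 * x)
    rw [← Real.sqrt_mul_self (sub_nonneg.2 ht)]
    congr 1
    linear_combination -htt
  rw [explicitG, hroot, hG]
  ring

theorem eventually_explicitG_explicitG : ∀ᶠ x in 𝓝 (0 : ℝ), explicitG (explicitG x) = x := by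
  have hc : ContinuousAt (fun x : ℝ => √(2 - 8 * √2 * x)) 0 :=
    (analyticAt_sqrt_radicand (by norm_num)).continuousAt
  have hlt : √(2 - 8 * √2 * 0) < 2 * √2 := by
    have : 0 < √(2 : ℝ) := by positivity
    rw [mul_zero, sub_zero]
    linarith
  filter_upwards [eventually_radicand_pos, hc.eventually_lt_const hlt] with x h1 h2
  exact explicitG_explicitG h1.le h2.le

theorem hasDerivAt_sqrt_radicand {x : ℝ} (hx : 0 < 2 - 8 * √2 * x) :
    HasDerivAt (fun y : ℝ => √(2 - 8 * √2 * y)) (-(4 * √2) / √(2 - 8 * √2 * x)) x := by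
  have h1 : HasDerivAt (fun y : ℝ => 2 - 8 * √2 * y) (-(8 * √2)) x := by
    simpa using ((hasDerivAt_id x).const_mul (8 * √2)).const_sub 2
  convert h1.sqrt hx.ne' using 1
  have : √(2 - 8 * √2 * x) ≠ 0 := (Real.sqrt_pos.2 hx).ne'
  field_simp
  ring

/-- With `t = √(2 - 8 √2 x)`, the solution is `f = (-x - t + √2 log (√2 + t)) / lam`. -/
theorem exists_dualityMap_eq_explicitG {lam : ℝ} (hlam : 0 < lam) :
    ∃ f : ℝ → ℝ, AnalyticAt ℝ f 0 ∧ ∀ᶠ x in 𝓝 (0 : ℝ), dualityMap lam f x = explicitG x := by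
  have hs0 : 0 < √(2 : ℝ) := by positivity
  refine ⟨fun x => lam⁻¹ * (-x - √(2 - 8 * √2 * x) +
    √2 * Real.log (√2 + √(2 - 8 * √2 * x))), ?_, ?_⟩
  · have h := analyticAt_sqrt_radicand (x := 0) (by norm_num)
    have hl : AnalyticAt ℝ (fun x => Real.log (√2 + √(2 - 8 * √2 * x))) 0 :=
      (analyticAt_const.add h).log (add_pos_of_pos_of_nonneg hs0 (Real.sqrt_nonneg _))
    exact analyticAt_const.mul ((analyticAt_id.neg.sub h).add (analyticAt_const.mul hl))
  · filter_upwards [eventually_radicand_pos] with x hx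
    have h := hasDerivAt_sqrt_radicand hx
    have ht0 : 0 < √(2 - 8 * √2 * x) := Real.sqrt_pos.2 hx
    have hd := ((((hasDerivAt_id x).fun_neg.fun_sub h).fun_add
      (((h.const_add √2).log (by positivity)).const_mul √2)).const_mul lam⁻¹).deriv
    simp only [id] at hd
    have hst : √2 + √(2 - 8 * √2 * x) ≠ 0 := by positivity
    rw [dualityMap, hd, explicitG]
    have htt := Real.mul_self_sqrt hx.le
    have hs := sqrt_two_mul_self
    set t := √(2 - 8 * √2 * x)
    have ht1 : t ≠ 0 := ht0.ne'
    -- `x` is eliminated in favour of `t`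
    have hx' : x = √2 * (2 - t * t) / 16 := by
      rw [htt]
      linear_combination (-(1 / 2) * x) * hs
    have e1 : -1 - -(4 * √2) / t + √2 * (-(4 * √2) / t / (√2 + t)) =
        -1 + 4 * √2 / (√2 + t) := by
      field_simp
      ring
    have e2 : x * (4 * √2 / (√2 + t)) = (√2 - t) / 2 := by
      rw [hx']
      field_simp
      linear_combination (-8 * t ^ 2) * hs
    have e3 : -lam * x * (lam⁻¹ * (-1 - -(4 * √2) / t + √2 * (-(4 * √2) / t / (√2 + t)))) =
        x - x * (4 * √2 / (√2 + t)) := by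
      rw [e1]
      field_simp
      ring
    rw [e3, e2]
    ring

/-- The successive derivatives of `x f'(x) = -G(x) / lam`. -/
theorem conformalFactor_of_dualityMap_eq {lam : ℝ} {f : ℝ → ℝ} {x : ℝ} (hf : AnalyticAt ℝ f x)
    (hG : ∀ᶠ y in 𝓝 x, dualityMap lam f y = explicitG y) (hx : 0 < 2 - 8 * √2 * x) :
    lam * (deriv f x + x * deriv (deriv f) x) = 2 * √2 / √(2 - 8 * √2 * x) - 1 ∧
    lam * (2 * deriv (deriv f) x + x * deriv (deriv (deriv f)) x) =
      16 / √(2 - 8 * √2 * x) ^ 3 ∧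
    lam * (3 * deriv (deriv (deriv f)) x + x * deriv (deriv (deriv (deriv f))) x) =
      192 * √2 / √(2 - 8 * √2 * x) ^ 5 := by
  have hs := sqrt_two_mul_self
  have hpos : ∀ᶠ y in 𝓝 x, 0 < 2 - 8 * √2 * y := by
    have hc : ContinuousAt (fun y : ℝ => 2 - 8 * √2 * y) x := by fun_prop
    exact hc.eventually_const_lt hx
  have e1 : ∀ᶠ y in 𝓝 x,
      lam * (deriv f y + y * deriv (deriv f) y) = 2 * √2 / √(2 - 8 * √2 * y) - 1 := by
    filter_upwards [hG.eventually_nhds, hf.eventually_analyticAt, hpos] with y hy hfy hpy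
    have h1 := ((hasDerivAt_id y).const_mul (-lam)).mul hfy.deriv.differentiableAt.hasDerivAt
    have h2 := ((hasDerivAt_id y).const_add (-(√2 / 2))).add
      ((hasDerivAt_sqrt_radicand hpy).const_mul (1 / 2))
    have h3 := h1.unique (h2.congr_of_eventuallyEq hy)
    simp only [id] at h3
    linear_combination -h3
  have e2 : ∀ᶠ y in 𝓝 x, lam * (2 * deriv (deriv f) y + y * deriv (deriv (deriv f)) y) =
      16 / √(2 - 8 * √2 * y) ^ 3 := by
    filter_upwards [e1.eventually_nhds, hf.eventually_analyticAt, hpos] with y hy hfy hpy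
    have ht : √(2 - 8 * √2 * y) ≠ 0 := (Real.sqrt_pos.2 hpy).ne'
    have h1 := (hfy.deriv.differentiableAt.hasDerivAt.fun_add ((hasDerivAt_id y).fun_mul
      hfy.deriv.deriv.differentiableAt.hasDerivAt)).const_mul lam
    have h2 := (((hasDerivAt_sqrt_radicand hpy).fun_inv ht).const_mul (2 * √2)).sub_const 1
    have h3 := h1.unique (h2.congr_of_eventuallyEq hy)
    simp only [id] at h3
    have h4 : ∀ t : ℝ, t ≠ 0 → 2 * √2 * (-(-(4 * √2) / t) / t ^ 2) = 16 / t ^ 3 := by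
      intro t ht
      field_simp
      linear_combination 8 * hs
    rw [← h4 _ ht, ← h3]
    ring
  refine ⟨e1.self_of_nhds, e2.self_of_nhds, ?_⟩
  have ht : √(2 - 8 * √2 * x) ≠ 0 := (Real.sqrt_pos.2 hx).ne'
  have h1 := ((hf.deriv.deriv.differentiableAt.hasDerivAt.const_mul 2).fun_add
    ((hasDerivAt_id x).fun_mul
      hf.deriv.deriv.deriv.differentiableAt.hasDerivAt)).const_mul lam
  have h2 := (((hasDerivAt_sqrt_radicand hx).fun_pow 3).fun_inv (pow_ne_zero 3 ht)).const_mul 16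
  have h3 := h1.unique (h2.congr_of_eventuallyEq e2)
  simp only [id] at h3
  refine Eq.trans ?_ (h3.trans ?_)
  · ring
  · push_cast
    field_simp
    ring

/-- In terms of `t = √(2 - 8 √2 |z|²)` constancy of the radial curvature is a polynomial equation
for `t` whose constant term does not vanish. -/
theorem polynomial_eq_of_holomorphicSectionalCurvature {lam : ℝ} (hlam : 0 < lam) {f : ℝ → ℝ}
    {z : Cn n} (hz : z ≠ 0) (hf : AnalyticAt ℝ f (‖z‖ ^ 2)) (h1 : 0 < deriv f (‖z‖ ^ 2))
    (h2 : 0 < deriv f (‖z‖ ^ 2) + ‖z‖ ^ 2 * deriv (deriv f) (‖z‖ ^ 2))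
    (hG : ∀ᶠ y in 𝓝 (‖z‖ ^ 2), dualityMap lam f y = explicitG y)
    {t c : ℝ} (ht : 0 < t) (hzt : 2 - 8 * √2 * ‖z‖ ^ 2 = t ^ 2)
    (hc : holomorphicSectionalCurvature (radialPotential n f) z z = c) :
    -(64 * √2) + 48 * t - 8 * t ^ 3 = c / (2 * lam) * ((2 * √2 - t) * t) ^ 3 := by
  have hs := sqrt_two_mul_self
  have hroot : √(2 - 8 * √2 * ‖z‖ ^ 2) = t := by rw [hzt, Real.sqrt_sq ht.le]
  obtain ⟨c1, c2, c3⟩ := conformalFactor_of_dualityMap_eq hf hG (by rw [hzt]; positivity)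
  rw [hroot] at c1 c2 c3
  have k1 : deriv f (‖z‖ ^ 2) + ‖z‖ ^ 2 * deriv (deriv f) (‖z‖ ^ 2) =
      (2 * √2 - t) / (lam * t) := by
    rw [eq_div_iff (by positivity)]
    have : lam * (deriv f (‖z‖ ^ 2) + ‖z‖ ^ 2 * deriv (deriv f) (‖z‖ ^ 2)) * t =
        2 * √2 - t := by
      rw [c1]
      field_simp
    linear_combination this
  have k2 : 2 * deriv (deriv f) (‖z‖ ^ 2) + ‖z‖ ^ 2 * deriv (deriv (deriv f)) (‖z‖ ^ 2) =
      16 / (lam * t ^ 3) := by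
    rw [mul_comm lam, ← div_div, ← c2]
    field_simp
  have k3 : 3 * deriv (deriv (deriv f)) (‖z‖ ^ 2) +
      ‖z‖ ^ 2 * deriv (deriv (deriv (deriv f))) (‖z‖ ^ 2) = 192 * √2 / (lam * t ^ 5) := by
    rw [mul_comm lam, ← div_div, ← c3]
    field_simp
  have hpos := h2
  rw [k1] at hpos
  have hnum : 0 < 2 * √2 - t := by
    rwa [div_pos_iff_of_pos_right (by positivity)] at hpos
  have hr : ‖z‖ ^ 2 = √2 * (2 - t ^ 2) / 16 := by
    rw [← hzt]
    linear_combination (-(1 / 2) * ‖z‖ ^ 2) * hs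
  rw [holomorphicSectionalCurvature_radialPotential hz hf h1 k1 hpos k2 k3, hr] at hc
  rw [← hc]
  have hnum' : √2 * 2 - t ≠ 0 := by
    rw [mul_comm]
    exact hnum.ne'
  field_simp
  linear_combination 192 * (2 * √2 - t) * (2 - t ^ 2) * hs

/-- The radial curvature is not constant on any non-empty open set: otherwise the polynomial
equation for `t` would hold on an interval, hence identically, and it fails at `t = 0`. -/
theorem not_hasConstantHolomorphicCurvatureOn {lam : ℝ} (hlam : 0 < lam) {f : ℝ → ℝ}
    (hn : 1 ≤ n) {W : Set (Cn n)} (hW : IsOpen W) (hne : W.Nonempty)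
    (H : ∀ z ∈ W, (AnalyticAt ℝ f (‖z‖ ^ 2) ∧ 0 < deriv f (‖z‖ ^ 2) ∧
      0 < deriv f (‖z‖ ^ 2) + ‖z‖ ^ 2 * deriv (deriv f) (‖z‖ ^ 2)) ∧
      (∀ᶠ y in 𝓝 (‖z‖ ^ 2), dualityMap lam f y = explicitG y) ∧ 0 < 2 - 8 * √2 * ‖z‖ ^ 2) :
    ¬ HasConstantHolomorphicCurvatureOn (radialPotential n f) W := by
  rintro ⟨c, hc⟩
  have hs := sqrt_two_mul_self
  have : Nonempty (Fin n) := ⟨⟨0, hn⟩⟩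
  have : (𝓝[≠] (0 : Cn n)).NeBot := Module.punctured_nhds_neBot ℝ (Cn n) 0
  obtain ⟨w, hwW, hw⟩ := (dense_compl_singleton (0 : Cn n)).inter_open_nonempty W hW hne
  have hw0 : w ≠ 0 := hw
  have hwn : 0 < ‖w‖ ^ 2 := by positivity
  have hwpos := (H w hwW).2.2
  set t₀ := √(2 - 8 * √2 * ‖w‖ ^ 2) with ht₀
  have ht₀pos : 0 < t₀ := Real.sqrt_pos.2 hwpos
  -- the point on the ray of `w` at which the radical takes the value `t`
  set ζ : ℝ → Cn n := fun t => √(√2 * (2 - t ^ 2) / 16 / ‖w‖ ^ 2) • w with hζ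
  have hX₀ : √2 * (2 - t₀ ^ 2) / 16 = ‖w‖ ^ 2 := by
    rw [ht₀, Real.sq_sqrt hwpos.le]
    linear_combination (1 / 2 * ‖w‖ ^ 2) * hs
  have hζ₀ : ζ t₀ = w := by
    simp only [hζ]
    rw [hX₀, div_self hwn.ne', Real.sqrt_one, one_smul]
  have hζc : Continuous ζ := by fun_prop
  have hev : ∀ᶠ t in 𝓝 t₀, -(64 * √2) + 48 * t - 8 * t ^ 3 =
      c / (2 * lam) * ((2 * √2 - t) * t) ^ 3 := by
    have hX : Continuous fun t : ℝ => √2 * (2 - t ^ 2) / 16 := by fun_prop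
    have hXpos : ∀ᶠ t in 𝓝 t₀, 0 < √2 * (2 - t ^ 2) / 16 :=
      hX.continuousAt.eventually_const_lt (by simpa only [hX₀] using hwn)
    have hζW : ∀ᶠ t in 𝓝 t₀, ζ t ∈ W :=
      hζc.continuousAt.eventually_mem (hW.mem_nhds (by rw [hζ₀]; exact hwW))
    filter_upwards [hXpos, hζW, eventually_gt_nhds ht₀pos] with t hXt hWt ht
    have hnorm : ‖ζ t‖ ^ 2 = √2 * (2 - t ^ 2) / 16 := by
      simp only [hζ]
      rw [norm_smul, mul_pow, Real.norm_eq_abs, sq_abs, Real.sq_sqrt (by positivity)]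
      field_simp
    have hζ0 : ζ t ≠ 0 := by
      intro h0
      rw [← hnorm, h0] at hXt
      simp at hXt
    obtain ⟨⟨a1, a2, a3⟩, a4, -⟩ := H _ hWt
    refine polynomial_eq_of_holomorphicSectionalCurvature hlam hζ0 a1 a2 a3 a4 ht ?_
      (hc _ hWt _ hζ0)
    rw [hnorm]
    linear_combination (-(1 / 2) * (2 - t ^ 2)) * hs
  open Polynomial in
  have hP : (-C (64 * √2) + 48 * X - 8 * X ^ 3 -
      C (c / (2 * lam)) * ((C (2 * √2) - X) * X) ^ 3 : ℝ[X]) = 0 := by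
    refine Polynomial.eq_zero_of_infinite_isRoot _ ((infinite_of_mem_nhds t₀ hev).mono ?_)
    intro t ht
    simp only [Set.mem_ofPred_eq] at ht ⊢
    simp only [Polynomial.IsRoot.def, Polynomial.eval_sub, Polynomial.eval_add,
      Polynomial.eval_neg, Polynomial.eval_mul, Polynomial.eval_pow, Polynomial.eval_C,
      Polynomial.eval_X, Polynomial.eval_ofNat]
    linear_combination ht
  have h0 := congrArg (Polynomial.eval 0) hP
  simp at h0

end SymplecticDuality

open SymplecticDuality in
theorem mainTheorem7 :
    -- the radial duality equation is equivalent to `G(G(x)) = x`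
    (∀ lam : ℝ, 0 < lam → ∀ f : ℝ → ℝ, AnalyticAt ℝ f 0 →
      (RadialDualityEquation lam f ↔
        ∀ᶠ x in 𝓝 (0 : ℝ), dualityMap lam f (dualityMap lam f x) = x)) ∧
    -- the explicit function is an analytic involution near `0`
    (AnalyticAt ℝ explicitG 0 ∧ explicitG 0 = 0 ∧
      ∀ᶠ x in 𝓝 (0 : ℝ), explicitG (explicitG x) = x) ∧
    -- it comes from a radial Kähler metric with the stated properties
    (∀ n : ℕ, 1 ≤ n → ∀ lam : ℝ, 0 < lam →
      (∃ f : ℝ → ℝ, AnalyticAt ℝ f 0 ∧ ∀ᶠ x in 𝓝 (0 : ℝ), dualityMap lam f x = explicitG x) ∧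
      ∀ f : ℝ → ℝ, AnalyticAt ℝ f 0 →
        (∀ᶠ x in 𝓝 (0 : ℝ), dualityMap lam f x = explicitG x) →
        RadialDualityEquation lam f ∧ deriv f 0 = 1 / lam ∧
        ∃ R : ℝ, 0 < R ∧
          IsKahlerPotentialOn (radialPotential n f) (Metric.ball 0 R) ∧
          AdmitsSymplecticDuality lam (Metric.ball 0 R) (radialPotential n f) ∧
          ∀ W : Set (Cn n), IsOpen W → W.Nonempty → W ⊆ Metric.ball 0 R →
            ¬ HasConstantHolomorphicCurvatureOn (radialPotential n f) W) := by
  refine ⟨fun lam _ f hf => radialDualityEquation_iff hf,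
    ⟨analyticAt_explicitG, explicitG_zero, eventually_explicitG_explicitG⟩,
    fun n hn lam hlam => ⟨exists_dualityMap_eq_explicitG hlam, fun f hf hG => ?_⟩⟩
  have hRDE : RadialDualityEquation lam f := by
    rw [radialDualityEquation_iff hf]
    filter_upwards [hG, (tendsto_dualityMap hf).eventually hG, eventually_explicitG_explicitG]
      with x h1 h2 h3
    rw [h2, h1, h3]
  have hd : deriv f 0 = 1 / lam := by
    have h := (conformalFactor_of_dualityMap_eq hf hG (by norm_num)).1
    have hs : √(2 : ℝ) ≠ 0 := by positivity
    rw [zero_mul, add_zero, mul_zero, sub_zero, mul_div_cancel_right₀ _ hs] at h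
    rw [eq_div_iff hlam.ne']
    linear_combination h
  have hd0 : 0 < deriv f 0 := by rw [hd]; positivity
  obtain ⟨R, hR, H⟩ := exists_ball_norm_sq (n := n)
    ((eventually_isKahlerPotential hf hd0).and (hG.eventually_nhds.and eventually_radicand_pos))
  exact ⟨hRDE, hd, R, hR, isKahlerPotentialOn_radialPotential fun z hz => (H z hz).1,
    admitsSymplecticDuality_radialPotential hlam hf hd0 hRDE hR,
    fun W hW hne hWR => not_hasConstantHolomorphicCurvatureOn hlam hn hW hne
      fun z hz => H z (hWR hz)⟩
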